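/- **Setting.** Let $M$ be a smooth (Hausdorff, second countable, finite-dimensional) manifold without boundary, and let $A\to M$ and $V\to M$ be smooth real vector bundles of finite rank. Let $A$ be a Lie algebroid: $\Gamma(A)$ carries an $\mathbb R$-bilinear Lie bracket and there is a vector bundle map $\rho\colon A\to TM$ (the anchor) with $[\alpha,f\beta]=f[\alpha,\beta]+(\rho(\alpha)f)\beta$ for $f\in C^\infty(M)$. Let $V$ be a representation of $A$, i.e. it carries a map $\nabla^A\colon\Gamma(A)\times\Gamma(V)\to\Gamma(V)$ which is $\mathbb R$-bilinear, $C^\infty(M)$-linear in the first argument, satisfies $\nabla^A_\alpha(f\xi)=f\nabla^A_\alpha\xi+(\rho(\alpha)f)\xi$, and is flat: $\nabla^A_{[\alpha,\beta]}=[\nabla^A_\alpha,\nabla^A_\beta]$. The bundle $W:=\operatorname{End}V$ carries the induced representation $(\nabla^A_\alpha\varphi)\xi=\nabla^A_\alpha(\varphi\xi)-\varphi(\nabla^A_\alpha\xi)$. For $\gamma\in\Omega^1(M;W)$ put $(\mathcal L^A_\alpha\gamma)(X)=\nabla^A_\alpha(\gamma(X))-\gamma([\rho(\alpha),X])$. Let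 $W^{1,1}(A;W)$ be the space of pairs $c=(c_0,c_1)$ of an $\mathbb R$-linear map $c_0\colon\Gamma(A)\to\Omega^1(M;W)$ and a bundle map $c_1\colon A\to W$ with $c_0(f\alpha)=f\,c_0(\alpha)+\mathrm df\otimes c_1(\alpha)$. Such a $c$ is an *IM 1-form* if, for all $\alpha,\beta\in\Gamma(A)$, $$c_0([\alpha,\beta])=\mathcal L^A_\alpha c_0(\beta)-\mathcal L^A_\beta c_0(\alpha),\qquad c_1([\alpha,\beta])=\nabla^A_\alpha(c_1(\beta))-\iota_{\rho(\beta)}c_0(\alpha),$$ that is, $\delta^1c=0$ for the differential $\delta^1$ of the Weil complex; write $\Omega^1_{im}(A;W)=\ker\delta^1$. Let $\delta^0\colon\Omega^1(M;W)\to W^{1,1}(A;W)$ be given by $(\delta^0\gamma)_0(\alpha)=\mathcal L^A_\alpha\gamma$ and $(\delta^0\gamma)_1(\beta)=\iota_{\rho(\beta)}\gamma$. Its kernel $\Omega^1_{\mathrm{inv}}(M;W)$ is the space of *invariant* $1$-forms, and $H^{1,1}(A;W)=\ker\delta^1/\operatorname{im}\delta^0$. For a linear connection $\nabla$ on $V$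 with curvature $R^\nabla$, the *$A$-invariance form* $(T,\theta)\in W^{1,1}(A;\operatorname{End}V)$ is $$\theta(\alpha)=\nabla^A_\alpha-\nabla_{\rho(\alpha)},\qquad T(\alpha)=\mathrm d^\nabla\theta(\alpha)-\iota_{\rho(\alpha)}R^\nabla,$$ where $\mathrm d^\nabla$ uses the connection induced on $\operatorname{End}V$. The connection $\nabla$ is *$A$-invariant* if $\nabla^A_\alpha=\nabla_{\rho(\alpha)}$ and $\iota_{\rho(\alpha)}R^\nabla=0$ for all $\alpha$. **Theorem.** 1. For every linear connection $\nabla$ on $V$, its $A$-invariance form is an $\operatorname{End}V$-valued IM 1-form: $(T,\theta)\in\Omega^1_{im}(A;\operatorname{End}V)$. 2. The (possibly empty) set of $A$-invariant connections on $V$ is an affine space over $\Omega^1_{\mathrm{inv}}(M;\operatorname{End}V)$: if $\nabla$ is $A$-invariant and $\gamma$ is invariant, then $\nabla+\gamma$ is $A$-invariant; and for any two $A$-invariant connections $\nabla,\nabla'$ there is exactly one $\gamma\in\Omega^1_{\mathrm{inv}}(M;\operatorname{End}V)$ with $\nabla'=\nabla+\gamma$. 3. Linear connections on $V$ exist, and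 the class $[(T,\theta)]\in H^{1,1}(A;\operatorname{End}V)$ is the same for all of them. Denote it by $\mathrm{obs}$. 4. An $A$-invariant connection on $V$ exists if and only if $\mathrm{obs}=0$. -/

import Mathlib

open scoped Manifold ContDiff Topology Bundle
open Bundle

set_option linter.unusedSectionVars false

noncomputable section

namespace LieAlgd

section Sections

variable {E : Type*} [NormedAddCommGroup E] [NormedSpace ℝ E]
  {M : Type*} [TopologicalSpace M] [ChartedSpace E M]
  {F : Type*} [NormedAddCommGroup F] [NormedSpace ℝ F]
  {V : M → Type*} [TopologicalSpace (TotalSpace F V)]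
  [∀ x, AddCommGroup (V x)] [∀ x, Module ℝ (V x)] [∀ x, TopologicalSpace (V x)]
  [FiberBundle F V] [VectorBundle ℝ F V]

/-- Smooth functions on `M`. -/
abbrev Fn (E : Type*) [NormedAddCommGroup E] [NormedSpace ℝ E]
    (M : Type*) [TopologicalSpace M] [ChartedSpace E M] : Type _ :=
  C^∞⟮𝓘(ℝ, E), M; 𝓘(ℝ, ℝ), ℝ⟯

/-- Smooth sections of a vector bundle `V` with model fibre `F`. -/
abbrev Sec (E : Type*) [NormedAddCommGroup E] [NormedSpace ℝ E]
    {M : Type*} [TopologicalSpace M] [ChartedSpace E M]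
    (F : Type*) [NormedAddCommGroup F] [NormedSpace ℝ F]
    (V : M → Type*) [TopologicalSpace (TotalSpace F V)]
    [∀ x, AddCommGroup (V x)] [∀ x, Module ℝ (V x)] [∀ x, TopologicalSpace (V x)]
    [FiberBundle F V] : Type _ :=
  Cₛ^∞⟮𝓘(ℝ, E); F, V⟯

/-- The pointwise `C^∞(M)`-module structure on smooth sections. -/
instance : SMul (Fn E M) (Sec E F V) :=
  ⟨fun f s => ⟨fun x => f x • s x, f.contMDiff.smul_section s.contMDiff⟩⟩

@[simp] theorem fn_smul_apply (f : Fn E M) (s : Sec E F V) (x : M) :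
    (f • s) x = f x • s x := rfl

@[simp] theorem add_apply (s t : Sec E F V) (x : M) : (s + t) x = s x + t x := rfl

@[simp] theorem sub_apply (s t : Sec E F V) (x : M) : (s - t) x = s x - t x := rfl

@[simp] theorem neg_apply (s : Sec E F V) (x : M) : (-s) x = -s x := rfl

@[simp] theorem zero_apply (x : M) : (0 : Sec E F V) x = 0 := rfl

@[simp] theorem smul_apply (r : ℝ) (s : Sec E F V) (x : M) : (r • s) x = r • s x := rfl

theorem sum_apply {ι : Type*} (t : Finset ι) (s : ι → Sec E F V) (x : M) :
    (∑ i ∈ t, s i) x = ∑ i ∈ t, s i x := by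
  classical
  induction t using Finset.induction_on with
  | empty => simp
  | insert a t ha h => simp [Finset.sum_insert ha, h]

instance : Module (Fn E M) (Sec E F V) where
  one_smul s := by ext x; simp
  mul_smul f g s := by ext x; simp [mul_smul]
  smul_zero f := by ext x; simp
  smul_add f s t := by ext x; simp
  add_smul f g s := by ext x; simp [add_smul]
  zero_smul s := by ext x; simp

instance : IsScalarTower ℝ (Fn E M) (Sec E F V) where
  smul_assoc r f s := by ext x; simp [mul_smul]

instance : SMulCommClass (Fn E M) ℝ (Sec E F V) where
  smul_comm f r s := by ext x; exact smul_comm (f x) r (s x)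

end Sections

section Hom

variable {E : Type*} [NormedAddCommGroup E] [NormedSpace ℝ E]
  {M : Type*} [TopologicalSpace M] [ChartedSpace E M]
  {F₁ : Type*} [NormedAddCommGroup F₁] [NormedSpace ℝ F₁]
  {V₁ : M → Type*} [TopologicalSpace (TotalSpace F₁ V₁)]
  [∀ x, AddCommGroup (V₁ x)] [∀ x, Module ℝ (V₁ x)] [∀ x, TopologicalSpace (V₁ x)]
  [FiberBundle F₁ V₁] [VectorBundle ℝ F₁ V₁]
  {F₂ : Type*} [NormedAddCommGroup F₂] [NormedSpace ℝ F₂]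
  {V₂ : M → Type*} [TopologicalSpace (TotalSpace F₂ V₂)]
  [∀ x, AddCommGroup (V₂ x)] [∀ x, Module ℝ (V₂ x)] [∀ x, TopologicalSpace (V₂ x)]
  [∀ x, IsTopologicalAddGroup (V₂ x)] [∀ x, ContinuousSMul ℝ (V₂ x)]
  [FiberBundle F₂ V₂] [VectorBundle ℝ F₂ V₂]

/-- A shortcut for instance search. -/
instance continuousAdd_hom {W₁ W₂ : Type*} [AddCommGroup W₁] [Module ℝ W₁] [TopologicalSpace W₁]
    [AddCommGroup W₂] [Module ℝ W₂] [TopologicalSpace W₂] [IsTopologicalAddGroup W₂] :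
    ContinuousAdd (W₁ →L[ℝ] W₂) :=
  IsTopologicalAddGroup.toContinuousAdd

/-- Smooth sections of the bundle `Hom(V₁, V₂)`. -/
abbrev HomSec (E : Type*) [NormedAddCommGroup E] [NormedSpace ℝ E]
    {M : Type*} [TopologicalSpace M] [ChartedSpace E M]
    (F₁ : Type*) [NormedAddCommGroup F₁] [NormedSpace ℝ F₁]
    (V₁ : M → Type*) [TopologicalSpace (TotalSpace F₁ V₁)]
    [∀ x, AddCommGroup (V₁ x)] [∀ x, Module ℝ (V₁ x)] [∀ x, TopologicalSpace (V₁ x)]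
    [FiberBundle F₁ V₁] [VectorBundle ℝ F₁ V₁]
    (F₂ : Type*) [NormedAddCommGroup F₂] [NormedSpace ℝ F₂]
    (V₂ : M → Type*) [TopologicalSpace (TotalSpace F₂ V₂)]
    [∀ x, AddCommGroup (V₂ x)] [∀ x, Module ℝ (V₂ x)] [∀ x, TopologicalSpace (V₂ x)]
    [∀ x, IsTopologicalAddGroup (V₂ x)] [∀ x, ContinuousSMul ℝ (V₂ x)]
    [FiberBundle F₂ V₂] [VectorBundle ℝ F₂ V₂] : Type _ :=
  Sec E (F₁ →L[ℝ] F₂) (fun x => V₁ x →L[ℝ] V₂ x)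

instance : AddCommGroup (HomSec E F₁ V₁ F₂ V₂) := ContMDiffSection.instAddCommGroup

instance : Module ℝ (HomSec E F₁ V₁ F₂ V₂) := ContMDiffSection.instModule

instance : Module (Fn E M) (HomSec E F₁ V₁ F₂ V₂) :=
  inferInstanceAs (Module (Fn E M) (Sec E (F₁ →L[ℝ] F₂) (fun x => V₁ x →L[ℝ] V₂ x)))

/-- A smooth section of `Hom(V₁, V₂)` acts on smooth sections. -/
def HomSec.toLin (φ : HomSec E F₁ V₁ F₂ V₂) : Sec E F₁ V₁ →ₗ[Fn E M] Sec E F₂ V₂ where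
  toFun s := ⟨fun x => φ x (s x), φ.contMDiff.clm_bundle_apply s.contMDiff⟩
  map_add' s t := by ext x; simp
  map_smul' f s := by ext x; simp

theorem HomSec.toLin_apply (φ : HomSec E F₁ V₁ F₂ V₂) (s : Sec E F₁ V₁) (x : M) :
    HomSec.toLin φ s x = φ x (s x) := rfl

@[simp] theorem toLin_add (φ ψ : HomSec E F₁ V₁ F₂ V₂) (s : Sec E F₁ V₁) :
    HomSec.toLin (φ + ψ) s = HomSec.toLin φ s + HomSec.toLin ψ s := rfl

@[simp] theorem toLin_sub (φ ψ : HomSec E F₁ V₁ F₂ V₂) (s : Sec E F₁ V₁) :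
    HomSec.toLin (φ - ψ) s = HomSec.toLin φ s - HomSec.toLin ψ s := rfl

@[simp] theorem toLin_zero (s : Sec E F₁ V₁) :
    HomSec.toLin (0 : HomSec E F₁ V₁ F₂ V₂) s = 0 := rfl

@[simp] theorem toLin_smul (r : ℝ) (φ : HomSec E F₁ V₁ F₂ V₂) (s : Sec E F₁ V₁) :
    HomSec.toLin (r • φ) s = r • HomSec.toLin φ s := rfl

@[simp] theorem toLin_fn_smul (f : Fn E M) (φ : HomSec E F₁ V₁ F₂ V₂) (s : Sec E F₁ V₁) :
    HomSec.toLin (f • φ) s = f • HomSec.toLin φ s := rfl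

end Hom

section Tensor

variable {E : Type*} [NormedAddCommGroup E] [NormedSpace ℝ E] [FiniteDimensional ℝ E]
  {M : Type*} [TopologicalSpace M] [ChartedSpace E M] [IsManifold 𝓘(ℝ, E) ∞ M] [T2Space M]
  {F₁ : Type*} [NormedAddCommGroup F₁] [NormedSpace ℝ F₁] [FiniteDimensional ℝ F₁]
  {V₁ : M → Type*} [TopologicalSpace (TotalSpace F₁ V₁)]
  [∀ x, AddCommGroup (V₁ x)] [∀ x, Module ℝ (V₁ x)] [∀ x, TopologicalSpace (V₁ x)]
  [FiberBundle F₁ V₁] [VectorBundle ℝ F₁ V₁] [ContMDiffVectorBundle ∞ F₁ V₁ 𝓘(ℝ, E)]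
  {F₂ : Type*} [NormedAddCommGroup F₂] [NormedSpace ℝ F₂]
  {V₂ : M → Type*} [TopologicalSpace (TotalSpace F₂ V₂)]
  [∀ x, AddCommGroup (V₂ x)] [∀ x, Module ℝ (V₂ x)] [∀ x, TopologicalSpace (V₂ x)]
  [∀ x, IsTopologicalAddGroup (V₂ x)] [∀ x, ContinuousSMul ℝ (V₂ x)]
  [FiberBundle F₂ V₂] [VectorBundle ℝ F₂ V₂] [ContMDiffVectorBundle ∞ F₂ V₂ 𝓘(ℝ, E)]

/-- Around every point there are global smooth functions and sections that cut off the
coefficients and the members of a local frame. -/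
theorem exists_cutoff_frame (E : Type*) [NormedAddCommGroup E] [NormedSpace ℝ E]
    [FiniteDimensional ℝ E]
    {M : Type*} [TopologicalSpace M] [ChartedSpace E M] [IsManifold 𝓘(ℝ, E) ∞ M] [T2Space M]
    (F₁ : Type*) [NormedAddCommGroup F₁] [NormedSpace ℝ F₁] [FiniteDimensional ℝ F₁]
    (V₁ : M → Type*) [TopologicalSpace (TotalSpace F₁ V₁)]
    [∀ x, AddCommGroup (V₁ x)] [∀ x, Module ℝ (V₁ x)] [∀ x, TopologicalSpace (V₁ x)]
    [FiberBundle F₁ V₁] [VectorBundle ℝ F₁ V₁] [ContMDiffVectorBundle ∞ F₁ V₁ 𝓘(ℝ, E)]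
    (x₀ : M) :
    ∃ (ψ : Fn E M) (s : Fin (Module.finrank ℝ F₁) → Sec E F₁ V₁)
      (c : Fin (Module.finrank ℝ F₁) → Sec E F₁ V₁ → Fn E M),
      (∀ᶠ x in 𝓝 x₀, ψ x = 1) ∧
      (∀ᶠ x in 𝓝 x₀, ∀ i, (trivializationAt F₁ V₁ x₀ ⟨x, s i x⟩).2 =
        Module.finBasis ℝ F₁ i) ∧
      (∀ i σ τ x, σ x = τ x → c i σ x = c i τ x) ∧
      (∀ σ, ψ • ψ • σ = ∑ i, c i σ • s i) := by
  classical
  have : ContMDiffVectorBundle 1 F₁ V₁ 𝓘(ℝ, E) := ContMDiffVectorBundle.of_le (n := ∞) (by simp)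
  set t := trivializationAt F₁ V₁ x₀ with ht
  set b := Module.finBasis ℝ F₁ with hb
  have hx₀ : x₀ ∈ t.baseSet := FiberBundle.mem_baseSet_trivializationAt F₁ V₁ x₀
  obtain ⟨ψ, -, hψ⟩ := (SmoothBumpFunction.nhds_basis_tsupport (I := 𝓘(ℝ, E)) x₀).mem_iff.mp
    (t.open_baseSet.mem_nhds hx₀)
  let s (i) : Sec E F₁ V₁ := ⟨fun x => ψ x • t.localFrame b i x,
    ContMDiffOn.smul_section_of_tsupport ψ.contMDiff.contMDiffOn t.open_baseSet hψ
      (t.contMDiffOn_localFrame_baseSet _ b i)⟩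
  let c (i) (σ : Sec E F₁ V₁) : Fn E M :=
    ⟨fun x => ψ x • t.localFrameCoeff 𝓘(ℝ, E) b i x (σ x), by
      refine contMDiff_of_tsupport fun x hx => ?_
      have hx' : x ∈ t.baseSet := hψ (tsupport_smul_subset_left _ _ hx)
      exact ψ.contMDiffAt.smul (contMDiffAt_localFrameCoeff b hx' σ.contMDiff.contMDiffAt i)⟩
  refine ⟨⟨ψ, ψ.contMDiff⟩, s, c, ψ.eventuallyEq_one, ?_, ?_, ?_⟩
  · filter_upwards [ψ.eventuallyEq_one, t.open_baseSet.mem_nhds hx₀] with x hx hxt i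
    have : s i x = t.basisAt b hxt i := by
      change ψ x • t.localFrame b i x = _
      rw [hx]; simp [hxt]
    rw [this]
    simp [Trivialization.basisAt, hxt]
  · intro i σ τ x h
    change ψ x • t.localFrameCoeff 𝓘(ℝ, E) b i x (σ x) = ψ x • _
    rw [h]
  · intro σ
    ext x
    rw [sum_apply]
    change ψ x • ψ x • σ x = ∑ i, (ψ x • t.localFrameCoeff 𝓘(ℝ, E) b i x (σ x)) •
      (ψ x • t.localFrame b i x)
    by_cases hx : x ∈ t.baseSet
    · conv_lhs => rw [t.eq_sum_localFrameCoeff_smul (I := 𝓘(ℝ, E)) (b := b) (s := σ) hx]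
      rw [Finset.smul_sum, Finset.smul_sum]
      refine Finset.sum_congr rfl fun i _ => ?_
      simp only [smul_smul, smul_eq_mul]
      congr 1; ring
    · have : ψ x = 0 := image_eq_zero_of_notMem_tsupport fun h => hx (hψ h)
      simp [this]

/-- A `C^∞(M)`-linear map between sections is pointwise. -/
theorem lin_congr (L : Sec E F₁ V₁ →ₗ[Fn E M] Sec E F₂ V₂) {σ τ : Sec E F₁ V₁} {x : M}
    (h : σ x = τ x) : L σ x = L τ x := by
  obtain ⟨ψ, s, c, hψ, -, hc, hsum⟩ := exists_cutoff_frame E F₁ V₁ x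
  have key (σ : Sec E F₁ V₁) : L σ x = ∑ i, c i σ x • L (s i) x := by
    have h1 : L (ψ • ψ • σ) x = L σ x := by
      simp [hψ.self_of_nhds]
    rw [← h1, hsum, map_sum, sum_apply]
    simp
  rw [key, key]
  exact Finset.sum_congr rfl fun i _ => by rw [hc i σ τ x h]

/-- Every vector in a fibre is the value of a global smooth section. -/
theorem exists_section (E : Type*) [NormedAddCommGroup E] [NormedSpace ℝ E]
    [FiniteDimensional ℝ E]
    {M : Type*} [TopologicalSpace M] [ChartedSpace E M] [IsManifold 𝓘(ℝ, E) ∞ M] [T2Space M]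
    (F₁ : Type*) [NormedAddCommGroup F₁] [NormedSpace ℝ F₁] [FiniteDimensional ℝ F₁]
    {V₁ : M → Type*} [TopologicalSpace (TotalSpace F₁ V₁)]
    [∀ x, AddCommGroup (V₁ x)] [∀ x, Module ℝ (V₁ x)] [∀ x, TopologicalSpace (V₁ x)]
    [FiberBundle F₁ V₁] [VectorBundle ℝ F₁ V₁] [ContMDiffVectorBundle ∞ F₁ V₁ 𝓘(ℝ, E)]
    {x : M} (v : V₁ x) : ∃ σ : Sec E F₁ V₁, σ x = v := by
  obtain ⟨ψ, s, c, -, hs, -⟩ := exists_cutoff_frame E F₁ V₁ x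
  have hx : x ∈ (trivializationAt F₁ V₁ x).baseSet :=
    FiberBundle.mem_baseSet_trivializationAt F₁ V₁ x
  let e := (trivializationAt F₁ V₁ x).linearEquivAt ℝ x hx
  refine ⟨∑ i, (Module.finBasis ℝ F₁).repr (e v) i • s i, e.injective ?_⟩
  rw [sum_apply, map_sum]
  have h (i) : e (s i x) = Module.finBasis ℝ F₁ i := hs.self_of_nhds i
  simp only [smul_apply, map_smul, h]
  exact (Module.finBasis ℝ F₁).sum_repr (e v)

/-- The value at `x` of the bundle map that a `C^∞(M)`-linear map of sections comes from. -/
def pointwiseHom (L : Sec E F₁ V₁ →ₗ[Fn E M] Sec E F₂ V₂) (x : M) : V₁ x →L[ℝ] V₂ x :=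
  haveI : T2Space (V₁ x) := FiberBundle.t2Space F₁ V₁ x
  haveI : FiniteDimensional ℝ (V₁ x) := VectorBundle.finiteDimensional ℝ F₁ V₁ x
  haveI : IsTopologicalAddGroup (V₁ x) :=
    (VectorBundle.continuousLinearEquivAt ℝ F₁ V₁ x).toContinuousAddEquiv.isTopologicalAddGroup
  haveI : ContinuousSMul ℝ (V₁ x) :=
    (VectorBundle.continuousLinearEquivAt ℝ F₁ V₁ x).continuousSMul
  LinearMap.toContinuousLinearMap
    { toFun := fun v => L (exists_section E F₁ v).choose x
      map_add' := fun v w => by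
        rw [← add_apply, ← map_add]
        refine lin_congr L ?_
        rw [add_apply, (exists_section E F₁ (v + w)).choose_spec,
          (exists_section E F₁ v).choose_spec, (exists_section E F₁ w).choose_spec]
      map_smul' := fun r v => by
        rw [RingHom.id_apply, ← smul_apply, ← LinearMap.map_smul_of_tower]
        refine lin_congr L ?_
        rw [smul_apply, (exists_section E F₁ (r • v)).choose_spec,
          (exists_section E F₁ v).choose_spec] }

theorem pointwiseHom_apply (L : Sec E F₁ V₁ →ₗ[Fn E M] Sec E F₂ V₂) (σ : Sec E F₁ V₁) (x : M) :
    pointwiseHom L x (σ x) = L σ x :=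
  lin_congr L (exists_section E F₁ (σ x)).choose_spec

theorem contMDiff_pointwiseHom (L : Sec E F₁ V₁ →ₗ[Fn E M] Sec E F₂ V₂) :
    ContMDiff 𝓘(ℝ, E) (𝓘(ℝ, E).prod 𝓘(ℝ, F₁ →L[ℝ] F₂)) ∞
      (fun x => TotalSpace.mk' (F₁ →L[ℝ] F₂) (E := fun x => V₁ x →L[ℝ] V₂ x) x
        (pointwiseHom L x)) := by
  intro x₀
  obtain ⟨ψ, s, c, -, hs, -⟩ := exists_cutoff_frame E F₁ V₁ x₀
  set t₁ := trivializationAt F₁ V₁ x₀ with ht₁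
  set t₂ := trivializationAt F₂ V₂ x₀ with ht₂
  have hx₁ : x₀ ∈ t₁.baseSet := FiberBundle.mem_baseSet_trivializationAt F₁ V₁ x₀
  have hx₂ : x₀ ∈ t₂.baseSet := FiberBundle.mem_baseSet_trivializationAt F₂ V₂ x₀
  set b := Module.finBasis ℝ F₁ with hb
  rw [contMDiffAt_hom_bundle]
  refine ⟨contMDiffAt_id, ?_⟩
  let g (i) (x : M) : F₂ := (t₂ ⟨x, L (s i) x⟩).2
  have hg (i) : ContMDiffAt 𝓘(ℝ, E) 𝓘(ℝ, F₂) ∞ (g i) x₀ :=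
    (t₂.contMDiffAt_section_iff hx₂).1 (L (s i)).contMDiff.contMDiffAt
  let B (i) : F₂ →L[ℝ] (F₁ →L[ℝ] F₂) :=
    ContinuousLinearMap.smulRightL ℝ F₁ F₂ (LinearMap.toContinuousLinearMap (b.coord i))
  have hsm : ContMDiffAt 𝓘(ℝ, E) 𝓘(ℝ, F₁ →L[ℝ] F₂) ∞ (fun x => ∑ i, B i (g i x)) x₀ :=
    ContMDiffAt.sum fun i _ => (B i).contMDiff.contMDiffAt.comp x₀ (hg i)
  refine hsm.congr_of_eventuallyEq ?_
  filter_upwards [hs, t₁.open_baseSet.mem_nhds hx₁, t₂.open_baseSet.mem_nhds hx₂] with x hx h1 h2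
  apply ContinuousLinearMap.coe_injective
  refine b.ext fun i => ?_
  have hsi : t₁.symm x (b i) = s i x := by
    rw [← hx i]
    exact t₁.symm_apply_apply_mk h1 _
  have key : ContinuousLinearMap.inCoordinates F₁ V₁ F₂ V₂ x₀ x x₀ x (pointwiseHom L x) (b i) =
      g i x := by
    rw [ContinuousLinearMap.inCoordinates_eq h1 h2]
    change (t₂ ⟨x, pointwiseHom L x (t₁.symm x (b i))⟩).2 = _
    rw [hsi, pointwiseHom_apply]
  refine key.trans ?_
  change _ = (∑ j, B j (g j x)) (b i)
  rw [_root_.sum_apply, Finset.sum_eq_single i]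
  · simp [B]
  · intro j _ hj
    simp [B, hj.symm]
  · simp

/-- A `C^∞(M)`-linear map `Γ(V₁) → Γ(V₂)`, viewed as a smooth section of `Hom(V₁, V₂)`. -/
def homOfLin (L : Sec E F₁ V₁ →ₗ[Fn E M] Sec E F₂ V₂) : HomSec E F₁ V₁ F₂ V₂ :=
  ⟨pointwiseHom L, contMDiff_pointwiseHom L⟩

@[simp] theorem toLin_homOfLin (L : Sec E F₁ V₁ →ₗ[Fn E M] Sec E F₂ V₂) :
    HomSec.toLin (homOfLin L) = L := by
  ext σ x
  exact pointwiseHom_apply L σ x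

theorem homSec_ext {φ φ' : HomSec E F₁ V₁ F₂ V₂}
    (h : ∀ σ, HomSec.toLin φ σ = HomSec.toLin φ' σ) : φ = φ' := by
  ext x v
  obtain ⟨σ, rfl⟩ := exists_section E F₁ v
  exact congrArg (fun s : Sec E F₂ V₂ => s x) (h σ)

end Tensor

section VectorFields

theorem two_le_infty : (2 : WithTop ℕ∞) ≤ ∞ :=
  (WithTop.coe_le_coe.mpr le_top : ((2 : ℕ∞) : WithTop ℕ∞) ≤ ((⊤ : ℕ∞) : WithTop ℕ∞))

theorem three_le_infty : (3 : WithTop ℕ∞) ≤ ∞ :=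
  (WithTop.coe_le_coe.mpr le_top : ((3 : ℕ∞) : WithTop ℕ∞) ≤ ((⊤ : ℕ∞) : WithTop ℕ∞))

variable {E : Type*} [NormedAddCommGroup E] [NormedSpace ℝ E] [FiniteDimensional ℝ E]
  {M : Type*} [TopologicalSpace M] [ChartedSpace E M] [IsManifold 𝓘(ℝ, E) ∞ M]

/-- Smooth vector fields on `M`. -/
abbrev VF (E : Type*) [NormedAddCommGroup E] [NormedSpace ℝ E]
    (M : Type*) [TopologicalSpace M] [ChartedSpace E M] [IsManifold 𝓘(ℝ, E) ∞ M] : Type _ :=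
  Sec E E (TangentSpace 𝓘(ℝ, E) : M → Type _)

/-- The derivative `X f` of a smooth function `f` along a vector field `X`. -/
def vd (X : VF E M) (f : Fn E M) : Fn E M :=
  ⟨fun x => mvfderiv 𝓘(ℝ, E) f x (X x), by
    have h1 := (contMDiff_snd_tangentBundle_modelSpace ℝ 𝓘(ℝ, ℝ) (n := ∞))
    have h2 := (ContMDiff.contMDiff_tangentMap (m := ∞) f.contMDiff (by simp)).comp X.contMDiff
    exact h1.comp h2⟩

/-- The Lie bracket of vector fields. -/
def br (X Y : VF E M) : VF E M :=
  ⟨VectorField.mlieBracket 𝓘(ℝ, E) X Y, fun x => by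
    have : IsManifold 𝓘(ℝ, E) (minSmoothness ℝ 2) M :=
      IsManifold.of_le (n := ∞) (by simpa using two_le_infty)
    have : IsManifold 𝓘(ℝ, E) (((⊤ : ℕ∞) : WithTop ℕ∞) + 1) M := by simpa
    refine ContMDiffAt.mlieBracket_vectorField (m := ⊤) (n := ⊤) X.contMDiff.contMDiffAt
      Y.contMDiff.contMDiffAt (by simp)⟩

theorem vd_apply (X : VF E M) (f : Fn E M) (x : M) :
    vd X f x = mvfderiv 𝓘(ℝ, E) f x (X x) := rfl

theorem br_apply (X Y : VF E M) (x : M) :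
    br X Y x = VectorField.mlieBracket 𝓘(ℝ, E) X Y x := rfl

theorem fn_mdiff (f : Fn E M) (x : M) : MDifferentiableAt 𝓘(ℝ, E) 𝓘(ℝ, ℝ) f x :=
  f.contMDiff.mdifferentiableAt (by simp)

@[simp] theorem vd_add_left (X Y : VF E M) (f : Fn E M) : vd (X + Y) f = vd X f + vd Y f := by
  ext x; simp [vd_apply]

@[simp] theorem vd_sub_left (X Y : VF E M) (f : Fn E M) : vd (X - Y) f = vd X f - vd Y f := by
  ext x; simp [vd_apply]

@[simp] theorem vd_fn_smul_left (g : Fn E M) (X : VF E M) (f : Fn E M) :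
    vd (g • X) f = g * vd X f := by
  ext x; simp [vd_apply]

@[simp] theorem vd_mul (X : VF E M) (f g : Fn E M) :
    vd X (f * g) = f * vd X g + g * vd X f := by
  ext x
  simp only [vd_apply, ContMDiffMap.coe_mul, ContMDiffMap.coe_add, Pi.add_apply, Pi.mul_apply]
  rw [mvfderiv_mul (fn_mdiff f x) (fn_mdiff g x)]
  rfl

@[simp] theorem vd_add (X : VF E M) (f g : Fn E M) : vd X (f + g) = vd X f + vd X g := by
  ext x
  simp only [vd_apply, ContMDiffMap.coe_add, Pi.add_apply]
  rw [mvfderiv_add (fn_mdiff f x) (fn_mdiff g x)]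
  rfl

theorem br_swap (X Y : VF E M) : br X Y = -br Y X := by
  ext x
  exact VectorField.mlieBracket_swap_apply

@[simp] theorem br_add_right (X Y Z : VF E M) : br X (Y + Z) = br X Y + br X Z := by
  ext x
  exact VectorField.mlieBracket_add_right Y.mdifferentiableAt Z.mdifferentiableAt

@[simp] theorem br_add_left (X Y Z : VF E M) : br (X + Y) Z = br X Z + br Y Z := by
  ext x
  exact VectorField.mlieBracket_add_left X.mdifferentiableAt Y.mdifferentiableAt

theorem br_smul_left (r : ℝ) (X Y : VF E M) : br (r • X) Y = r • br X Y := by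
  ext x
  exact VectorField.mlieBracket_const_smul_left X.mdifferentiableAt

theorem br_fn_smul_right (X : VF E M) (f : Fn E M) (Y : VF E M) :
    br X (f • Y) = vd X f • Y + f • br X Y := by
  ext x
  exact VectorField.mlieBracket_smul_right (fn_mdiff f x) Y.mdifferentiableAt

theorem br_fn_smul_left (f : Fn E M) (X Y : VF E M) :
    br (f • X) Y = -(vd Y f • X) + f • br X Y := by
  rw [br_swap, br_fn_smul_right, br_swap Y X]
  simp only [smul_neg]; abel

theorem br_jacobi (X Y Z : VF E M) : br X (br Y Z) = br (br X Y) Z + br Y (br X Z) := by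
  ext x
  have : IsManifold 𝓘(ℝ, E) (minSmoothness ℝ 3) M := IsManifold.of_le (n := ∞) (by simpa using three_le_infty)
  exact VectorField.leibniz_identity_mlieBracket_apply (X.contMDiff.contMDiffAt.of_le (by simpa using two_le_infty))
    (Y.contMDiff.contMDiffAt.of_le (by simpa using two_le_infty)) (Z.contMDiff.contMDiffAt.of_le (by simpa using two_le_infty))

/-- The Lie bracket acts on functions as the commutator. -/
theorem vd_br [T2Space M] (X Y : VF E M) (f : Fn E M) :
    vd (br X Y) f = vd X (vd Y f) - vd Y (vd X f) := by
  have key (Z : VF E M) : vd (br X Y) f • Z = (vd X (vd Y f) - vd Y (vd X f)) • Z := by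
    have h := br_jacobi X Y (f • Z)
    simp only [br_fn_smul_right, br_add_right] at h
    rw [br_jacobi X Y Z] at h
    rw [sub_smul, ← sub_eq_zero]
    rw [← sub_eq_zero] at h
    rw [← neg_eq_zero, ← h]
    simp only [smul_add]
    abel
  ext x
  by_cases hX : ∃ v : TangentSpace 𝓘(ℝ, E) x, v ≠ 0
  · obtain ⟨v, hv⟩ := hX
    obtain ⟨Z, rfl⟩ := exists_section E E v
    have := congrArg (fun s : VF E M => s x) (key Z)
    exact smul_left_injective ℝ hv this
  · push Not at hX
    simp [vd_apply, hX (X x), hX (Y x), hX (br X Y x)]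

end VectorFields
section Algebroids

variable {E : Type*} [NormedAddCommGroup E] [NormedSpace ℝ E] [FiniteDimensional ℝ E]
  {M : Type*} [TopologicalSpace M] [ChartedSpace E M] [IsManifold 𝓘(ℝ, E) ∞ M] [T2Space M]
  {FA : Type*} [NormedAddCommGroup FA] [NormedSpace ℝ FA] [FiniteDimensional ℝ FA]
  {A : M → Type*} [TopologicalSpace (TotalSpace FA A)]
  [∀ x, AddCommGroup (A x)] [∀ x, Module ℝ (A x)] [∀ x, TopologicalSpace (A x)]
  [FiberBundle FA A] [VectorBundle ℝ FA A] [ContMDiffVectorBundle ∞ FA A 𝓘(ℝ, E)]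
  {F : Type*} [NormedAddCommGroup F] [NormedSpace ℝ F] [FiniteDimensional ℝ F]
  {V : M → Type*} [TopologicalSpace (TotalSpace F V)]
  [∀ x, AddCommGroup (V x)] [∀ x, Module ℝ (V x)] [∀ x, TopologicalSpace (V x)]
  [∀ x, IsTopologicalAddGroup (V x)] [∀ x, ContinuousSMul ℝ (V x)]
  [FiberBundle F V] [VectorBundle ℝ F V] [ContMDiffVectorBundle ∞ F V 𝓘(ℝ, E)]

/-- A Lie algebroid structure on the vector bundle `A`: a Lie bracket on the smooth sections and
an anchor `A → TM`, related by the Leibniz rule. -/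
structure LieAlgebroid (E : Type*) [NormedAddCommGroup E] [NormedSpace ℝ E]
    {M : Type*} [TopologicalSpace M] [ChartedSpace E M] [IsManifold 𝓘(ℝ, E) ∞ M]
    (FA : Type*) [NormedAddCommGroup FA] [NormedSpace ℝ FA]
    (A : M → Type*) [TopologicalSpace (TotalSpace FA A)]
    [∀ x, AddCommGroup (A x)] [∀ x, Module ℝ (A x)] [∀ x, TopologicalSpace (A x)]
    [FiberBundle FA A] [VectorBundle ℝ FA A] where
  /-- The bracket `[α, β]`. -/
  bracket : Sec E FA A →ₗ[ℝ] Sec E FA A →ₗ[ℝ] Sec E FA A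
  bracket_self : ∀ α, bracket α α = 0
  jacobi : ∀ α β γ,
    bracket α (bracket β γ) + bracket β (bracket γ α) + bracket γ (bracket α β) = 0
  /-- The anchor, a smooth bundle map `A → TM` over the identity. -/
  anchor : HomSec E FA A E (TangentSpace 𝓘(ℝ, E) : M → Type _)
  leibniz : ∀ (α : Sec E FA A) (f : Fn E M) (β : Sec E FA A),
    bracket α (f • β) = f • bracket α β + vd (HomSec.toLin anchor α) f • β

/-- The anchor on sections. -/
def LieAlgebroid.ρ (𝓐 : LieAlgebroid E FA A) : Sec E FA A →ₗ[Fn E M] VF E M :=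
  HomSec.toLin 𝓐.anchor

theorem LieAlgebroid.bracket_swap (𝓐 : LieAlgebroid E FA A) (α β : Sec E FA A) :
    𝓐.bracket α β = -𝓐.bracket β α := by
  have h := 𝓐.bracket_self (α + β)
  simp only [map_add, LinearMap.add_apply, 𝓐.bracket_self, zero_add, add_zero] at h
  exact eq_neg_of_add_eq_zero_right h

theorem LieAlgebroid.bracket_fn_smul_right (𝓐 : LieAlgebroid E FA A) (α : Sec E FA A)
    (f : Fn E M) (β : Sec E FA A) :
    𝓐.bracket α (f • β) = f • 𝓐.bracket α β + vd (𝓐.ρ α) f • β :=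
  𝓐.leibniz α f β

theorem LieAlgebroid.bracket_fn_smul_left (𝓐 : LieAlgebroid E FA A) (f : Fn E M)
    (α β : Sec E FA A) :
    𝓐.bracket (f • α) β = f • 𝓐.bracket α β - vd (𝓐.ρ β) f • α := by
  rw [𝓐.bracket_swap, 𝓐.bracket_fn_smul_right, 𝓐.bracket_swap β α]
  simp only [smul_neg]; abel

/-- A connection on `V` along an anchor `ρ : Γ(A) → 𝔛(M)`: a map `(α, ξ) ↦ D_α ξ` which is
`ℝ`-bilinear, `C^∞(M)`-linear in `α`, and a derivation over `ρ(α)` in `ξ`. -/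
structure AConnection (ρ : Sec E FA A →ₗ[Fn E M] VF E M)
    (F : Type*) [NormedAddCommGroup F] [NormedSpace ℝ F]
    (V : M → Type*) [TopologicalSpace (TotalSpace F V)]
    [∀ x, AddCommGroup (V x)] [∀ x, Module ℝ (V x)] [∀ x, TopologicalSpace (V x)]
    [FiberBundle F V] [VectorBundle ℝ F V] where
  /-- The operator `D_α`. -/
  D : Sec E FA A → Sec E F V →ₗ[ℝ] Sec E F V
  add_left : ∀ α β ξ, D (α + β) ξ = D α ξ + D β ξ
  smul_left : ∀ (f : Fn E M) α ξ, D (f • α) ξ = f • D α ξ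
  leibniz : ∀ α (f : Fn E M) ξ, D α (f • ξ) = f • D α ξ + vd (ρ α) f • ξ

attribute [simp] AConnection.add_left AConnection.smul_left

/-- A linear connection on `V`. -/
abbrev LinearConnection (E : Type*) [NormedAddCommGroup E] [NormedSpace ℝ E]
    {M : Type*} [TopologicalSpace M] [ChartedSpace E M] [IsManifold 𝓘(ℝ, E) ∞ M]
    (F : Type*) [NormedAddCommGroup F] [NormedSpace ℝ F]
    (V : M → Type*) [TopologicalSpace (TotalSpace F V)]
    [∀ x, AddCommGroup (V x)] [∀ x, Module ℝ (V x)] [∀ x, TopologicalSpace (V x)]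
    [FiberBundle F V] [VectorBundle ℝ F V] : Type _ :=
  AConnection (LinearMap.id : VF E M →ₗ[Fn E M] VF E M) F V

/-- A representation of a Lie algebroid on `V`: a flat connection along its anchor. -/
structure Representation (𝓐 : LieAlgebroid E FA A)
    (F : Type*) [NormedAddCommGroup F] [NormedSpace ℝ F]
    (V : M → Type*) [TopologicalSpace (TotalSpace F V)]
    [∀ x, AddCommGroup (V x)] [∀ x, Module ℝ (V x)] [∀ x, TopologicalSpace (V x)]
    [FiberBundle F V] [VectorBundle ℝ F V] extends AConnection 𝓐.ρ F V where
  flat : ∀ α β ξ, D (𝓐.bracket α β) ξ = D α (D β ξ) - D β (D α ξ)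

/-- Sections of the endomorphism bundle `End V`. -/
abbrev EndSec (E : Type*) [NormedAddCommGroup E] [NormedSpace ℝ E]
    {M : Type*} [TopologicalSpace M] [ChartedSpace E M]
    (F : Type*) [NormedAddCommGroup F] [NormedSpace ℝ F]
    (V : M → Type*) [TopologicalSpace (TotalSpace F V)]
    [∀ x, AddCommGroup (V x)] [∀ x, Module ℝ (V x)] [∀ x, TopologicalSpace (V x)]
    [∀ x, IsTopologicalAddGroup (V x)] [∀ x, ContinuousSMul ℝ (V x)]
    [FiberBundle F V] [VectorBundle ℝ F V] : Type _ :=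
  HomSec E F V F V

/-- The induced connection on `End V`: `(D_α φ) ξ = D_α (φ ξ) - φ (D_α ξ)`. -/
def AConnection.onEnd {ρ : Sec E FA A →ₗ[Fn E M] VF E M} (D : AConnection ρ F V) :
    AConnection ρ (F →L[ℝ] F) (fun x => V x →L[ℝ] V x) where
  D α :=
    { toFun := fun φ => homOfLin
        { toFun := fun ξ => D.D α (HomSec.toLin φ ξ) - HomSec.toLin φ (D.D α ξ)
          map_add' := fun ξ η => by simp only [map_add]; abel
          map_smul' := fun f ξ => by
            simp only [map_smul, D.leibniz, map_add, RingHom.id_apply, smul_sub]; abel }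
      map_add' := fun φ ψ => homSec_ext fun ξ => by
        simp; abel
      map_smul' := fun r φ => homSec_ext fun ξ => by
        simp [smul_sub] }
  add_left α β φ := homSec_ext fun ξ => by simp; abel
  smul_left f α φ := homSec_ext fun ξ => by
    simp [smul_sub]
  leibniz α f φ := homSec_ext fun ξ => by
    simp [D.leibniz, smul_sub]
    abel

end Algebroids
section Weil

variable {E : Type*} [NormedAddCommGroup E] [NormedSpace ℝ E] [FiniteDimensional ℝ E]
  {M : Type*} [TopologicalSpace M] [ChartedSpace E M] [IsManifold 𝓘(ℝ, E) ∞ M] [T2Space M]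
  {FA : Type*} [NormedAddCommGroup FA] [NormedSpace ℝ FA] [FiniteDimensional ℝ FA]
  {A : M → Type*} [TopologicalSpace (TotalSpace FA A)]
  [∀ x, AddCommGroup (A x)] [∀ x, Module ℝ (A x)] [∀ x, TopologicalSpace (A x)]
  [FiberBundle FA A] [VectorBundle ℝ FA A] [ContMDiffVectorBundle ∞ FA A 𝓘(ℝ, E)]
  {F : Type*} [NormedAddCommGroup F] [NormedSpace ℝ F]
  {V : M → Type*} [TopologicalSpace (TotalSpace F V)]
  [∀ x, AddCommGroup (V x)] [∀ x, Module ℝ (V x)] [∀ x, TopologicalSpace (V x)]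
  [∀ x, IsTopologicalAddGroup (V x)] [∀ x, ContinuousSMul ℝ (V x)]
  [FiberBundle F V] [VectorBundle ℝ F V] [ContMDiffVectorBundle ∞ F V 𝓘(ℝ, E)]

theorem AConnection.real_smul_left {ρ : Sec E FA A →ₗ[Fn E M] VF E M} (D : AConnection ρ F V)
    (r : ℝ) (α : Sec E FA A) (ξ : Sec E F V) : D.D (r • α) ξ = r • D.D α ξ := by
  rw [← smul_one_smul (Fn E M) r α, D.smul_left, smul_one_smul]

/-- `V`-valued differential 1-forms: smooth sections of `Hom(TM, V)`. The value on a vector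
field `X` is `HomSec.toLin γ X`. -/
abbrev Form1 (E : Type*) [NormedAddCommGroup E] [NormedSpace ℝ E]
    {M : Type*} [TopologicalSpace M] [ChartedSpace E M] [IsManifold 𝓘(ℝ, E) ∞ M]
    (F : Type*) [NormedAddCommGroup F] [NormedSpace ℝ F]
    (V : M → Type*) [TopologicalSpace (TotalSpace F V)]
    [∀ x, AddCommGroup (V x)] [∀ x, Module ℝ (V x)] [∀ x, TopologicalSpace (V x)]
    [∀ x, IsTopologicalAddGroup (V x)] [∀ x, ContinuousSMul ℝ (V x)]
    [FiberBundle F V] [VectorBundle ℝ F V] : Type _ :=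
  HomSec E E (TangentSpace 𝓘(ℝ, E) : M → Type _) F V

/-- The 1-form `df ⊗ ξ`, with value `(X f) ξ` on `X`. -/
def dTensor (f : Fn E M) (ξ : Sec E F V) : Form1 E F V :=
  homOfLin
    { toFun := fun X => vd X f • ξ
      map_add' := fun X Y => by simp [add_smul]
      map_smul' := fun g X => by simp [mul_smul] }

theorem dTensor_apply (f : Fn E M) (ξ : Sec E F V) (X : VF E M) :
    HomSec.toLin (dTensor f ξ) X = vd X f • ξ := by simp [dTensor]

/-- The Lie derivative of a 1-form along `α`, induced by a representation:
`(L_α γ)(X) = D_α (γ X) - γ [ρ α, X]`. -/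
def Representation.lie {𝓐 : LieAlgebroid E FA A} (R : Representation 𝓐 F V)
    (α : Sec E FA A) : Form1 E F V →ₗ[ℝ] Form1 E F V where
  toFun γ := homOfLin
    { toFun := fun X => R.D α (HomSec.toLin γ X) - HomSec.toLin γ (br (𝓐.ρ α) X)
      map_add' := fun X Y => by simp; abel
      map_smul' := fun f X => by
        simp [br_fn_smul_right, R.leibniz, smul_sub]; abel }
  map_add' γ γ' := homSec_ext fun X => by simp; abel
  map_smul' r γ := homSec_ext fun X => by simp [smul_sub]

theorem Representation.lie_apply {𝓐 : LieAlgebroid E FA A} (R : Representation 𝓐 F V)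
    (α : Sec E FA A) (γ : Form1 E F V) (X : VF E M) :
    HomSec.toLin (R.lie α γ) X =
      R.D α (HomSec.toLin γ X) - HomSec.toLin γ (br (𝓐.ρ α) X) := by
  simp [Representation.lie]

theorem Representation.lie_add_left {𝓐 : LieAlgebroid E FA A} (R : Representation 𝓐 F V)
    (α β : Sec E FA A) (γ : Form1 E F V) : R.lie (α + β) γ = R.lie α γ + R.lie β γ :=
  homSec_ext fun X => by simp [R.lie_apply]; abel

theorem Representation.lie_smul_left {𝓐 : LieAlgebroid E FA A} (R : Representation 𝓐 F V)
    (r : ℝ) (α : Sec E FA A) (γ : Form1 E F V) : R.lie (r • α) γ = r • R.lie α γ :=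
  homSec_ext fun X => by
    have h : 𝓐.ρ (r • α) = r • 𝓐.ρ α := LinearMap.map_smul_of_tower _ _ _
    simp [R.lie_apply, R.real_smul_left, h, br_smul_left, smul_sub]

variable (E FA A F V) in
/-- The Weil cochains `W^{1,1}(A; V)`: pairs `(c₀, c₁)` of an `ℝ`-linear map
`c₀ : Γ(A) → Ω¹(M; V)` and a section `c₁` of `A* ⊗ V = Hom(A, V)`, subject to
`c₀(f α) = f c₀(α) + df ⊗ c₁(α)`. -/
def weil11 :
    Submodule ℝ ((Sec E FA A →ₗ[ℝ] Form1 E F V) × HomSec E FA A F V) where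
  carrier := {c | ∀ (f : Fn E M) (α : Sec E FA A),
    c.1 (f • α) = f • c.1 α + dTensor f (HomSec.toLin c.2 α)}
  zero_mem' f α := homSec_ext fun X => by simp [dTensor_apply]
  add_mem' := fun {c c'} hc hc' f α => homSec_ext fun X => by
    have h := hc f α
    have h' := hc' f α
    simp only [Prod.fst_add, Prod.snd_add, LinearMap.add_apply, h, h']
    simp [dTensor_apply]
    abel
  smul_mem' := fun r c hc f α => homSec_ext fun X => by
    have h := hc f α
    simp only [Prod.smul_fst, Prod.smul_snd, LinearMap.smul_apply, h]
    simp [dTensor_apply, smul_comm r]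

variable (E FA A F V) in
/-- The Weil cochains `W^{2,1}(A; V)`: pairs `(c₀, c₁)` of an alternating `ℝ`-bilinear map
`c₀ : Γ(A) × Γ(A) → Ω¹(M; V)` and an `ℝ`-linear map `c₁ : Γ(A) → Γ(Hom(A, V))`, subject to
`c₀(f α, β) = f c₀(α, β) + df ⊗ c₁(β ‖ α)` and `c₁(f α ‖ β) = f c₁(α ‖ β)`. The next correction
term would take values in forms of degree `-1` and vanishes. -/
def weil21 :
    Submodule ℝ ((Sec E FA A →ₗ[ℝ] Sec E FA A →ₗ[ℝ] Form1 E F V) ×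
      (Sec E FA A →ₗ[ℝ] HomSec E FA A F V)) where
  carrier := {c | (∀ α, c.1 α α = 0) ∧
    (∀ (f : Fn E M) (α β : Sec E FA A),
      c.1 (f • α) β = f • c.1 α β + dTensor f (HomSec.toLin (c.2 β) α)) ∧
    (∀ (f : Fn E M) (α : Sec E FA A), c.2 (f • α) = f • c.2 α)}
  zero_mem' := ⟨fun α => rfl, fun f α β => homSec_ext fun X => by simp [dTensor_apply],
    fun f α => by simp⟩
  add_mem' := by
    rintro c c' ⟨h1, h2, h3⟩ ⟨h1', h2', h3'⟩
    refine ⟨fun α => by simp [h1, h1'], fun f α β => homSec_ext fun X => ?_, fun f α => ?_⟩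
    · simp only [Prod.fst_add, Prod.snd_add, LinearMap.add_apply, h2, h2']
      simp [dTensor_apply]
      abel
    · refine homSec_ext fun β => ?_
      simp [h3, h3']
  smul_mem' := by
    rintro r c ⟨h1, h2, h3⟩
    refine ⟨fun α => by simp [h1], fun f α β => homSec_ext fun X => ?_, fun f α => ?_⟩
    · simp only [Prod.smul_fst, Prod.smul_snd, LinearMap.smul_apply, h2]
      simp [dTensor_apply, smul_comm r]
    · simp [h3, smul_comm r]

variable (E FA A F V) in
/-- The space `W^{1,1}(A; V)`. -/
def W11 : Type _ := weil11 E FA A F V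

instance : AddCommGroup (W11 E FA A F V) := inferInstanceAs (AddCommGroup (weil11 E FA A F V))

instance : Module ℝ (W11 E FA A F V) := inferInstanceAs (Module ℝ (weil11 E FA A F V))

variable (E FA A F V) in
/-- The space `W^{2,1}(A; V)`. -/
def W21 : Type _ := weil21 E FA A F V

instance : AddCommGroup (W21 E FA A F V) := inferInstanceAs (AddCommGroup (weil21 E FA A F V))

instance : Module ℝ (W21 E FA A F V) := inferInstanceAs (Module ℝ (weil21 E FA A F V))

/-- Precomposition of a form with the anchor, `β ↦ ι_{ρ β} γ`, as a section of `Hom(A, V)`. -/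
def LieAlgebroid.contract (𝓐 : LieAlgebroid E FA A) (γ : Form1 E F V) : HomSec E FA A F V :=
  homOfLin ((HomSec.toLin γ).comp 𝓐.ρ)

theorem LieAlgebroid.contract_apply (𝓐 : LieAlgebroid E FA A) (γ : Form1 E F V)
    (β : Sec E FA A) : HomSec.toLin (𝓐.contract γ) β = HomSec.toLin γ (𝓐.ρ β) := by
  simp [LieAlgebroid.contract]

/-- The differential `δ⁰ : Ω¹(M; V) = W^{0,1}(A; V) → W^{1,1}(A; V)`,
`(δ⁰ γ)₀(α) = L_α γ`, `(δ⁰ γ)₁(β) = ι_{ρ β} γ`. -/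
def Representation.δ₀ {𝓐 : LieAlgebroid E FA A} (R : Representation 𝓐 F V) :
    Form1 E F V →ₗ[ℝ] W11 E FA A F V where
  toFun γ := ⟨({ toFun := fun α => R.lie α γ
                 map_add' := fun α β => R.lie_add_left α β γ
                 map_smul' := fun r α => R.lie_smul_left r α γ },
                𝓐.contract γ), fun f α => homSec_ext fun X => by
                  simp [R.lie_apply, dTensor_apply, 𝓐.contract_apply, br_fn_smul_left, smul_sub]
                  abel⟩
  map_add' γ γ' := by
    refine Subtype.ext (Prod.ext (LinearMap.ext fun α => ?_) (homSec_ext fun β => ?_))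
    · exact map_add (R.lie α) γ γ'
    · change HomSec.toLin (𝓐.contract (γ + γ')) β =
        HomSec.toLin (𝓐.contract γ) β + HomSec.toLin (𝓐.contract γ') β
      simp only [𝓐.contract_apply, toLin_add]
  map_smul' r γ := by
    refine Subtype.ext (Prod.ext (LinearMap.ext fun α => ?_) (homSec_ext fun β => ?_))
    · exact map_smul (R.lie α) r γ
    · change HomSec.toLin (𝓐.contract (r • γ)) β = r • HomSec.toLin (𝓐.contract γ) β
      simp only [𝓐.contract_apply, toLin_smul]

/-- The leading term of `δ¹ c`. -/
def Representation.d₁Zero {𝓐 : LieAlgebroid E FA A} (R : Representation 𝓐 F V)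
    (c : W11 E FA A F V) : Sec E FA A →ₗ[ℝ] Sec E FA A →ₗ[ℝ] Form1 E F V :=
  LinearMap.mk₂ ℝ
    (fun α β => R.lie α (c.1.1 β) - R.lie β (c.1.1 α) - c.1.1 (𝓐.bracket α β))
    (fun α α' β => by
      simp only [map_add, LinearMap.add_apply, R.lie_add_left]; abel)
    (fun r α β => by
      simp only [map_smul, LinearMap.smul_apply, R.lie_smul_left, smul_sub])
    (fun α β β' => by
      simp only [map_add, R.lie_add_left]; abel)
    (fun r α β => by
      simp only [map_smul, R.lie_smul_left, smul_sub])

theorem Representation.d₁Zero_apply {𝓐 : LieAlgebroid E FA A} (R : Representation 𝓐 F V)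
    (c : W11 E FA A F V) (α β : Sec E FA A) :
    R.d₁Zero c α β = R.lie α (c.1.1 β) - R.lie β (c.1.1 α) - c.1.1 (𝓐.bracket α β) := rfl

/-- The value of the correction term of `δ¹ c` on a section `α`. -/
def Representation.d₁OneAux {𝓐 : LieAlgebroid E FA A} (R : Representation 𝓐 F V)
    (c : W11 E FA A F V) (α : Sec E FA A) : HomSec E FA A F V :=
  homOfLin
    { toFun := fun β => -R.D α (HomSec.toLin c.1.2 β) +
        HomSec.toLin c.1.2 (𝓐.bracket α β) + HomSec.toLin (c.1.1 α) (𝓐.ρ β)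
      map_add' := fun β β' => by simp only [map_add]; abel
      map_smul' := fun f β => by
        simp only [map_smul, R.leibniz, 𝓐.bracket_fn_smul_right, map_add, RingHom.id_apply,
          smul_add, smul_neg]
        abel }

theorem Representation.d₁OneAux_apply {𝓐 : LieAlgebroid E FA A} (R : Representation 𝓐 F V)
    (c : W11 E FA A F V) (α β : Sec E FA A) :
    HomSec.toLin (R.d₁OneAux c α) β = -R.D α (HomSec.toLin c.1.2 β) +
      HomSec.toLin c.1.2 (𝓐.bracket α β) + HomSec.toLin (c.1.1 α) (𝓐.ρ β) := by
  rw [Representation.d₁OneAux, toLin_homOfLin]; rfl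

/-- The correction term of `δ¹ c`. -/
def Representation.d₁One {𝓐 : LieAlgebroid E FA A} (R : Representation 𝓐 F V)
    (c : W11 E FA A F V) : Sec E FA A →ₗ[ℝ] HomSec E FA A F V where
  toFun α := R.d₁OneAux c α
  map_add' α α' := homSec_ext fun β => by
    simp only [R.d₁OneAux_apply, toLin_add, map_add, LinearMap.add_apply, R.add_left]; abel
  map_smul' r α := homSec_ext fun β => by
    simp only [R.d₁OneAux_apply, toLin_smul, map_smul, LinearMap.smul_apply, R.real_smul_left,
      LinearMap.map_smul_of_tower, RingHom.id_apply, smul_add, smul_neg]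

theorem Representation.d₁One_apply {𝓐 : LieAlgebroid E FA A} (R : Representation 𝓐 F V)
    (c : W11 E FA A F V) (α β : Sec E FA A) :
    HomSec.toLin (R.d₁One c α) β = -R.D α (HomSec.toLin c.1.2 β) +
      HomSec.toLin c.1.2 (𝓐.bracket α β) + HomSec.toLin (c.1.1 α) (𝓐.ρ β) :=
  R.d₁OneAux_apply c α β

theorem Representation.lie_fn_smul_left {𝓐 : LieAlgebroid E FA A} (R : Representation 𝓐 F V)
    (f : Fn E M) (α : Sec E FA A) (γ : Form1 E F V) :
    R.lie (f • α) γ = f • R.lie α γ + dTensor f (HomSec.toLin γ (𝓐.ρ α)) :=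
  homSec_ext fun X => by
    simp only [R.lie_apply, dTensor_apply, toLin_add, toLin_fn_smul, R.smul_left, map_smul,
      br_fn_smul_left, map_add, map_neg, smul_sub]
    abel

theorem Representation.lie_fn_smul_right {𝓐 : LieAlgebroid E FA A} (R : Representation 𝓐 F V)
    (f : Fn E M) (α : Sec E FA A) (γ : Form1 E F V) :
    R.lie α (f • γ) = f • R.lie α γ + vd (𝓐.ρ α) f • γ :=
  homSec_ext fun X => by
    simp only [R.lie_apply, toLin_add, toLin_fn_smul, R.leibniz, smul_sub]
    abel

theorem Representation.lie_dTensor {𝓐 : LieAlgebroid E FA A} (R : Representation 𝓐 F V)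
    (f : Fn E M) (α : Sec E FA A) (ξ : Sec E F V) :
    R.lie α (dTensor f ξ) = dTensor (vd (𝓐.ρ α) f) ξ + dTensor f (R.D α ξ) :=
  homSec_ext fun X => by
    simp only [R.lie_apply, dTensor_apply, toLin_add, R.leibniz, vd_br, sub_smul]
    abel

theorem dTensor_add (f : Fn E M) (ξ η : Sec E F V) :
    dTensor f (ξ + η) = dTensor f ξ + dTensor f η :=
  homSec_ext fun X => by simp only [dTensor_apply, toLin_add, smul_add]

theorem dTensor_neg (f : Fn E M) (ξ : Sec E F V) :
    dTensor f (-ξ) = -dTensor f ξ := by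
  rw [eq_neg_iff_add_eq_zero, ← dTensor_add]
  refine homSec_ext fun X => ?_
  simp [dTensor_apply]

theorem Representation.d₁_mem {𝓐 : LieAlgebroid E FA A} (R : Representation 𝓐 F V)
    (c : W11 E FA A F V) : (R.d₁Zero c, R.d₁One c) ∈ weil21 E FA A F V := by
  refine ⟨fun α => ?_, fun f α β => ?_, fun f α => homSec_ext fun β => ?_⟩
  · simp [R.d₁Zero_apply, 𝓐.bracket_self]
  · have h1 := c.2 f α
    have h2 := c.2 f (𝓐.bracket α β)
    have h3 := c.2 (vd (𝓐.ρ β) f) α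
    change R.d₁Zero c (f • α) β = f • R.d₁Zero c α β + dTensor f (HomSec.toLin (R.d₁One c β) α)
    rw [R.d₁One_apply, 𝓐.bracket_swap β α]
    simp only [R.d₁Zero_apply, 𝓐.bracket_fn_smul_left, map_sub, map_add, map_neg, h1, h2, h3,
      R.lie_fn_smul_left, R.lie_fn_smul_right, R.lie_dTensor, dTensor_add, dTensor_neg]
    refine homSec_ext fun X => ?_
    simp only [toLin_add, toLin_sub, toLin_fn_smul, smul_sub]
    have hn (φ : Form1 E F V) : HomSec.toLin (-φ) X = -HomSec.toLin φ X := rfl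
    simp only [hn]
    abel
  · have h1 := c.2 f α
    change HomSec.toLin (R.d₁One c (f • α)) β = HomSec.toLin (f • R.d₁One c α) β
    simp only [toLin_fn_smul, R.d₁One_apply, 𝓐.bracket_fn_smul_left, h1, toLin_add,
      dTensor_apply, R.smul_left, map_sub, map_smul, smul_add, smul_neg]
    abel

/-- The differential `δ¹ : W^{1,1}(A; V) → W^{2,1}(A; V)`,
`(δ¹ c)₀(α, β) = L_α (c₀ β) - L_β (c₀ α) - c₀ [α, β]`,
`(δ¹ c)₁(α ‖ β) = -D_α (c₁ β) + c₁ [α, β] + ι_{ρ β} (c₀ α)`. -/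
def Representation.δ₁ {𝓐 : LieAlgebroid E FA A} (R : Representation 𝓐 F V) :
    W11 E FA A F V →ₗ[ℝ] W21 E FA A F V where
  toFun c := ⟨(R.d₁Zero c, R.d₁One c), R.d₁_mem c⟩
  map_add' c c' := by
    refine Subtype.ext (Prod.ext (LinearMap.ext₂ fun α β => ?_)
      (LinearMap.ext fun α => homSec_ext fun β => ?_))
    · change R.d₁Zero (c + c') α β = R.d₁Zero c α β + R.d₁Zero c' α β
      have h (α) : (c + c').1.1 α = c.1.1 α + c'.1.1 α := rfl
      simp only [R.d₁Zero_apply, h, map_add]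
      abel
    · change HomSec.toLin (R.d₁One (c + c') α) β =
        HomSec.toLin (R.d₁One c α) β + HomSec.toLin (R.d₁One c' α) β
      have h (α) : (c + c').1.1 α = c.1.1 α + c'.1.1 α := rfl
      have h' : (c + c').1.2 = c.1.2 + c'.1.2 := rfl
      simp only [R.d₁One_apply, h, h', map_add, toLin_add]
      abel
  map_smul' r c := by
    refine Subtype.ext (Prod.ext (LinearMap.ext₂ fun α β => ?_)
      (LinearMap.ext fun α => homSec_ext fun β => ?_))
    · change R.d₁Zero (r • c) α β = r • R.d₁Zero c α β
      have h (α) : (r • c).1.1 α = r • c.1.1 α := rfl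
      simp only [R.d₁Zero_apply, h, map_smul]
      exact homSec_ext fun X => by simp only [toLin_sub, toLin_smul, smul_sub]
    · change HomSec.toLin (R.d₁One (r • c) α) β = r • HomSec.toLin (R.d₁One c α) β
      have h (α) : (r • c).1.1 α = r • c.1.1 α := rfl
      have h' : (r • c).1.2 = r • c.1.2 := rfl
      simp only [R.d₁One_apply, h, h', map_smul, toLin_smul, smul_add, smul_neg]

end Weil
section Cohomology

variable {E : Type*} [NormedAddCommGroup E] [NormedSpace ℝ E] [FiniteDimensional ℝ E]
  {M : Type*} [TopologicalSpace M] [ChartedSpace E M] [IsManifold 𝓘(ℝ, E) ∞ M] [T2Space M]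
  {FA : Type*} [NormedAddCommGroup FA] [NormedSpace ℝ FA] [FiniteDimensional ℝ FA]
  {A : M → Type*} [TopologicalSpace (TotalSpace FA A)]
  [∀ x, AddCommGroup (A x)] [∀ x, Module ℝ (A x)] [∀ x, TopologicalSpace (A x)]
  [FiberBundle FA A] [VectorBundle ℝ FA A] [ContMDiffVectorBundle ∞ FA A 𝓘(ℝ, E)]
  {F : Type*} [NormedAddCommGroup F] [NormedSpace ℝ F]
  {V : M → Type*} [TopologicalSpace (TotalSpace F V)]
  [∀ x, AddCommGroup (V x)] [∀ x, Module ℝ (V x)] [∀ x, TopologicalSpace (V x)]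
  [∀ x, IsTopologicalAddGroup (V x)] [∀ x, ContinuousSMul ℝ (V x)]
  [FiberBundle F V] [VectorBundle ℝ F V] [ContMDiffVectorBundle ∞ F V 𝓘(ℝ, E)]

/-- Invariant `V`-valued 1-forms, the kernel of `δ⁰`. -/
def Representation.invForms {𝓐 : LieAlgebroid E FA A} (R : Representation 𝓐 F V) :
    Submodule ℝ (Form1 E F V) :=
  LinearMap.ker R.δ₀

/-- `V`-valued IM 1-forms, the kernel of `δ¹`. -/
def Representation.imForms {𝓐 : LieAlgebroid E FA A} (R : Representation 𝓐 F V) :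
    Submodule ℝ (W11 E FA A F V) :=
  LinearMap.ker R.δ₁

/-- The cohomology `H^{1,1}(A; V) = ker δ¹ / im δ⁰` of
`Ω¹(M; V) → W^{1,1}(A; V) → W^{2,1}(A; V)`. -/
abbrev Representation.H11 {𝓐 : LieAlgebroid E FA A} (R : Representation 𝓐 F V) : Type _ :=
  R.imForms ⧸ (LinearMap.range R.δ₀).submoduleOf R.imForms

/-- The class of an IM 1-form in `H^{1,1}(A; V)`. -/
def Representation.toH11 {𝓐 : LieAlgebroid E FA A} (R : Representation 𝓐 F V)
    (c : W11 E FA A F V) (hc : c ∈ R.imForms) : R.H11 :=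
  Submodule.Quotient.mk ⟨c, hc⟩

end Cohomology

section Invariance

variable {E : Type*} [NormedAddCommGroup E] [NormedSpace ℝ E] [FiniteDimensional ℝ E]
  {M : Type*} [TopologicalSpace M] [ChartedSpace E M] [IsManifold 𝓘(ℝ, E) ∞ M] [T2Space M]
  {FA : Type*} [NormedAddCommGroup FA] [NormedSpace ℝ FA] [FiniteDimensional ℝ FA]
  {A : M → Type*} [TopologicalSpace (TotalSpace FA A)]
  [∀ x, AddCommGroup (A x)] [∀ x, Module ℝ (A x)] [∀ x, TopologicalSpace (A x)]
  [FiberBundle FA A] [VectorBundle ℝ FA A] [ContMDiffVectorBundle ∞ FA A 𝓘(ℝ, E)]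
  {F : Type*} [NormedAddCommGroup F] [NormedSpace ℝ F] [FiniteDimensional ℝ F]
  {V : M → Type*} [TopologicalSpace (TotalSpace F V)]
  [∀ x, AddCommGroup (V x)] [∀ x, Module ℝ (V x)] [∀ x, TopologicalSpace (V x)]
  [∀ x, IsTopologicalAddGroup (V x)] [∀ x, ContinuousSMul ℝ (V x)]
  [FiberBundle F V] [VectorBundle ℝ F V] [ContMDiffVectorBundle ∞ F V 𝓘(ℝ, E)]

theorem AConnection.onEnd_apply {ρ : Sec E FA A →ₗ[Fn E M] VF E M} (D : AConnection ρ F V)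
    (α : Sec E FA A) (φ : EndSec E F V) (ξ : Sec E F V) :
    HomSec.toLin (D.onEnd.D α φ) ξ = D.D α (HomSec.toLin φ ξ) - HomSec.toLin φ (D.D α ξ) := by
  simp [AConnection.onEnd]

/-- The induced representation on `End V`. -/
def Representation.onEnd {𝓐 : LieAlgebroid E FA A} (R : Representation 𝓐 F V) :
    Representation 𝓐 (F →L[ℝ] F) (fun x => V x →L[ℝ] V x) where
  toAConnection := R.toAConnection.onEnd
  flat α β φ := homSec_ext fun ξ => by
    simp only [AConnection.onEnd_apply, R.flat, map_sub, toLin_sub]; abel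

/-- The covariant derivative `d^∇ φ` of a section, the 1-form `X ↦ ∇_X φ`. -/
def AConnection.covD (D : LinearConnection E F V) (φ : Sec E F V) : Form1 E F V :=
  homOfLin
    { toFun := fun X => D.D X φ
      map_add' := fun X Y => D.add_left X Y φ
      map_smul' := fun f X => D.smul_left f X φ }

theorem AConnection.covD_apply (D : LinearConnection E F V) (φ : Sec E F V) (X : VF E M) :
    HomSec.toLin (D.covD φ) X = D.D X φ := by
  rw [AConnection.covD, toLin_homOfLin]; rfl

/-- The curvature `R^∇(X, Y) ξ = ∇_X ∇_Y ξ - ∇_Y ∇_X ξ - ∇_{[X, Y]} ξ`, a section of `End V`. -/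
def AConnection.curv (D : LinearConnection E F V) (X Y : VF E M) : EndSec E F V :=
  homOfLin
    { toFun := fun ξ => D.D X (D.D Y ξ) - D.D Y (D.D X ξ) - D.D (br X Y) ξ
      map_add' := fun ξ η => by simp only [map_add]; abel
      map_smul' := fun f ξ => by
        simp only [D.leibniz, map_add, LinearMap.id_apply, vd_br, sub_smul, smul_sub,
          RingHom.id_apply]
        abel }

theorem AConnection.curv_apply (D : LinearConnection E F V) (X Y : VF E M) (ξ : Sec E F V) :
    HomSec.toLin (D.curv X Y) ξ =
      D.D X (D.D Y ξ) - D.D Y (D.D X ξ) - D.D (br X Y) ξ := by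
  rw [AConnection.curv, toLin_homOfLin]; rfl

end Invariance
section InvarianceForm

variable {E : Type*} [NormedAddCommGroup E] [NormedSpace ℝ E] [FiniteDimensional ℝ E]
  {M : Type*} [TopologicalSpace M] [ChartedSpace E M] [IsManifold 𝓘(ℝ, E) ∞ M] [T2Space M]
  {FA : Type*} [NormedAddCommGroup FA] [NormedSpace ℝ FA] [FiniteDimensional ℝ FA]
  {A : M → Type*} [TopologicalSpace (TotalSpace FA A)]
  [∀ x, AddCommGroup (A x)] [∀ x, Module ℝ (A x)] [∀ x, TopologicalSpace (A x)]
  [FiberBundle FA A] [VectorBundle ℝ FA A] [ContMDiffVectorBundle ∞ FA A 𝓘(ℝ, E)]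
  {F : Type*} [NormedAddCommGroup F] [NormedSpace ℝ F] [FiniteDimensional ℝ F]
  {V : M → Type*} [TopologicalSpace (TotalSpace F V)]
  [∀ x, AddCommGroup (V x)] [∀ x, Module ℝ (V x)] [∀ x, TopologicalSpace (V x)]
  [∀ x, IsTopologicalAddGroup (V x)] [∀ x, ContinuousSMul ℝ (V x)]
  [FiberBundle F V] [VectorBundle ℝ F V] [ContMDiffVectorBundle ∞ F V 𝓘(ℝ, E)]

/-- The contraction `ι_Y R^∇`, the `End V`-valued 1-form `X ↦ R^∇(Y, X)`. -/
def AConnection.iotaCurv (D : LinearConnection E F V) (Y : VF E M) :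
    Form1 E (F →L[ℝ] F) (fun x => V x →L[ℝ] V x) :=
  homOfLin
    { toFun := fun X => D.curv Y X
      map_add' := fun X X' => homSec_ext fun ξ => by
        simp only [D.curv_apply, toLin_add, D.add_left, map_add, br_add_right]; abel
      map_smul' := fun f X => homSec_ext fun ξ => by
        simp only [D.curv_apply, RingHom.id_apply, toLin_fn_smul, D.smul_left, D.leibniz,
          br_fn_smul_right, D.add_left, smul_sub, LinearMap.id_apply]
        abel }

theorem AConnection.iotaCurv_apply (D : LinearConnection E F V) (Y X : VF E M) :
    HomSec.toLin (D.iotaCurv Y) X = D.curv Y X := by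
  rw [AConnection.iotaCurv, toLin_homOfLin]; rfl

/-- The difference `∇^A_α - ∇_{ρ α}`, a section of `End V`. -/
def Representation.thetaAux {𝓐 : LieAlgebroid E FA A} (R : Representation 𝓐 F V)
    (D : LinearConnection E F V) (α : Sec E FA A) : EndSec E F V :=
  homOfLin
    { toFun := fun ξ => R.D α ξ - D.D (𝓐.ρ α) ξ
      map_add' := fun ξ η => by simp only [map_add]; abel
      map_smul' := fun f ξ => by
        simp only [R.leibniz, D.leibniz, LinearMap.id_apply, RingHom.id_apply, smul_sub]; abel }

theorem Representation.thetaAux_apply {𝓐 : LieAlgebroid E FA A} (R : Representation 𝓐 F V)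
    (D : LinearConnection E F V) (α : Sec E FA A) (ξ : Sec E F V) :
    HomSec.toLin (R.thetaAux D α) ξ = R.D α ξ - D.D (𝓐.ρ α) ξ := by
  rw [Representation.thetaAux, toLin_homOfLin]; rfl

/-- The section `θ` of `Hom(A, End V)`, `θ(α) = ∇^A_α - ∇_{ρ α}`. -/
def Representation.theta {𝓐 : LieAlgebroid E FA A} (R : Representation 𝓐 F V)
    (D : LinearConnection E F V) :
    HomSec E FA A (F →L[ℝ] F) (fun x => V x →L[ℝ] V x) :=
  homOfLin
    { toFun := fun α => R.thetaAux D α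
      map_add' := fun α β => homSec_ext fun ξ => by
        simp only [R.thetaAux_apply, toLin_add, R.add_left, map_add, D.add_left]; abel
      map_smul' := fun f α => homSec_ext fun ξ => by
        simp only [R.thetaAux_apply, toLin_fn_smul, R.smul_left, map_smul, D.smul_left,
          RingHom.id_apply, smul_sub] }

theorem Representation.theta_apply {𝓐 : LieAlgebroid E FA A} (R : Representation 𝓐 F V)
    (D : LinearConnection E F V) (α : Sec E FA A) (ξ : Sec E F V) :
    HomSec.toLin (HomSec.toLin (R.theta D) α) ξ = R.D α ξ - D.D (𝓐.ρ α) ξ := by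
  rw [Representation.theta, toLin_homOfLin]; exact R.thetaAux_apply D α ξ

/-- `T(α) = d^∇ θ(α) - ι_{ρ α} R^∇`, where `d^∇` uses the connection that `∇` induces
on `End V`. -/
def Representation.tAux {𝓐 : LieAlgebroid E FA A} (R : Representation 𝓐 F V)
    (D : LinearConnection E F V) (α : Sec E FA A) :
    Form1 E (F →L[ℝ] F) (fun x => V x →L[ℝ] V x) :=
  AConnection.covD D.onEnd (HomSec.toLin (R.theta D) α) - D.iotaCurv (𝓐.ρ α)

theorem Representation.tAux_apply {𝓐 : LieAlgebroid E FA A} (R : Representation 𝓐 F V)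
    (D : LinearConnection E F V) (α : Sec E FA A) (X : VF E M) :
    HomSec.toLin (R.tAux D α) X =
      D.onEnd.D X (HomSec.toLin (R.theta D) α) - D.curv (𝓐.ρ α) X := by
  rw [Representation.tAux, toLin_sub, AConnection.covD_apply, D.iotaCurv_apply]

theorem AConnection.curv_add_left (D : LinearConnection E F V) (X X' Y : VF E M) :
    D.curv (X + X') Y = D.curv X Y + D.curv X' Y :=
  homSec_ext fun ξ => by
    simp only [D.curv_apply, toLin_add, D.add_left, map_add, br_add_left]; abel

theorem AConnection.curv_fn_smul_left (D : LinearConnection E F V) (f : Fn E M) (X Y : VF E M) :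
    D.curv (f • X) Y = f • D.curv X Y :=
  homSec_ext fun ξ => by
    have hn (Z : VF E M) : D.D (-Z) ξ = -D.D Z ξ := by
      rw [eq_neg_iff_add_eq_zero, ← D.add_left, neg_add_cancel]
      simpa using D.smul_left 0 0 ξ
    simp only [D.curv_apply, toLin_fn_smul, D.smul_left, D.leibniz,
      br_fn_smul_left, D.add_left, hn, smul_sub, LinearMap.id_apply]
    abel

theorem Representation.tAux_add {𝓐 : LieAlgebroid E FA A} (R : Representation 𝓐 F V)
    (D : LinearConnection E F V) (α β : Sec E FA A) :
    R.tAux D (α + β) = R.tAux D α + R.tAux D β :=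
  homSec_ext fun X => by
    simp only [R.tAux_apply, toLin_add, map_add, AConnection.curv_add_left]; abel

theorem Representation.tAux_fn_smul {𝓐 : LieAlgebroid E FA A} (R : Representation 𝓐 F V)
    (D : LinearConnection E F V) (f : Fn E M) (α : Sec E FA A) :
    R.tAux D (f • α) = f • R.tAux D α + dTensor f (HomSec.toLin (R.theta D) α) :=
  homSec_ext fun X => homSec_ext fun ξ => by
    simp only [R.tAux_apply, toLin_add, toLin_sub, toLin_fn_smul, map_smul, dTensor_apply,
      AConnection.curv_fn_smul_left, AConnection.leibniz, LinearMap.id_apply, smul_sub]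
    abel

theorem Representation.tAux_smul {𝓐 : LieAlgebroid E FA A} (R : Representation 𝓐 F V)
    (D : LinearConnection E F V) (r : ℝ) (α : Sec E FA A) :
    R.tAux D (r • α) = r • R.tAux D α := by
  have h (s : Fn E M) (hs : ∀ X : VF E M, vd X s = 0) :
      R.tAux D (s • α) = s • R.tAux D α := by
    rw [R.tAux_fn_smul]
    refine homSec_ext fun X => ?_
    simp only [toLin_add, dTensor_apply, hs, zero_smul, add_zero]
  have h1 := h (r • 1) fun X => by
    ext x
    rw [vd_apply]
    have : (⇑(r • (1 : Fn E M)) : M → ℝ) = fun _ => r := by ext y; simp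
    rw [this, mvfderiv_const]; rfl
  rwa [smul_one_smul, smul_one_smul] at h1

/-- The `A`-invariance form `(T, θ)` of a linear connection. -/
def Representation.invarianceForm {𝓐 : LieAlgebroid E FA A} (R : Representation 𝓐 F V)
    (D : LinearConnection E F V) : W11 E FA A (F →L[ℝ] F) (fun x => V x →L[ℝ] V x) :=
  ⟨({ toFun := R.tAux D
      map_add' := R.tAux_add D
      map_smul' := R.tAux_smul D }, R.theta D), fun f α => R.tAux_fn_smul D f α⟩

/-- A linear connection is `A`-invariant if `∇^A_α = ∇_{ρ α}` and `ι_{ρ α} R^∇ = 0` for all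
sections `α` of `A`. -/
def Representation.IsInvariant {𝓐 : LieAlgebroid E FA A} (R : Representation 𝓐 F V)
    (D : LinearConnection E F V) : Prop :=
  (∀ α ξ, R.D α ξ = D.D (𝓐.ρ α) ξ) ∧ ∀ α, D.iotaCurv (𝓐.ρ α) = 0

/-- The translate `∇ + γ` of a linear connection by an `End V`-valued 1-form,
`(∇ + γ)_X ξ = ∇_X ξ + γ(X) ξ`. -/
def AConnection.translate (D : LinearConnection E F V)
    (γ : Form1 E (F →L[ℝ] F) (fun x => V x →L[ℝ] V x)) : LinearConnection E F V where
  D X :=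
    { toFun := fun ξ => D.D X ξ + HomSec.toLin (HomSec.toLin γ X) ξ
      map_add' := fun ξ η => by simp only [map_add]; abel
      map_smul' := fun r ξ => by
        simp only [map_smul, LinearMap.map_smul_of_tower, RingHom.id_apply, smul_add] }
  add_left X Y ξ := by
    simp only [LinearMap.coe_mk, AddHom.coe_mk, D.add_left, map_add, toLin_add]; abel
  smul_left f X ξ := by
    simp only [LinearMap.coe_mk, AddHom.coe_mk, D.smul_left, map_smul, toLin_fn_smul, smul_add]
  leibniz X f ξ := by
    simp only [LinearMap.coe_mk, AddHom.coe_mk, D.leibniz, map_smul, smul_add]; abel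

theorem AConnection.translate_apply (D : LinearConnection E F V)
    (γ : Form1 E (F →L[ℝ] F) (fun x => V x →L[ℝ] V x)) (X : VF E M) (ξ : Sec E F V) :
    (D.translate γ).D X ξ = D.D X ξ + HomSec.toLin (HomSec.toLin γ X) ξ := rfl

theorem AConnection.ext_apply {D D' : LinearConnection E F V}
    (h : ∀ X ξ, D.D X ξ = D'.D X ξ) : D = D' := by
  cases D; cases D'; congr; ext1 X; exact LinearMap.ext (h X)

/-- `End V`-valued 1-forms act on linear connections by translation. -/
instance : AddAction (Form1 E (F →L[ℝ] F) (fun x => V x →L[ℝ] V x)) (LinearConnection E F V) where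
  vadd γ D := D.translate γ
  zero_vadd D := AConnection.ext_apply fun X ξ => by
    change D.D X ξ + HomSec.toLin (HomSec.toLin 0 X) ξ = _
    rw [toLin_zero, toLin_zero, add_zero]
  add_vadd γ γ' D := AConnection.ext_apply fun X ξ => by
    change D.D X ξ + HomSec.toLin (HomSec.toLin (γ + γ') X) ξ =
      (D.D X ξ + HomSec.toLin (HomSec.toLin γ' X) ξ) + HomSec.toLin (HomSec.toLin γ X) ξ
    rw [toLin_add, toLin_add]; abel

end InvarianceForm
end LieAlgd

end

/-!
For a representation `∇^A` of a Lie algebroid on `V` and a linear connection `∇` on `V`, the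
component `T` of the invariance form simplifies: the curvature cancels and
`T(α)(X) = -([∇^A_α, ∇_X] - ∇_{[ρ α, X]})` (`Representation.tAux_apply_apply`). Together with
`θ(α) = ∇^A_α - ∇_{ρ α}` this makes `(T, θ)` an affine function of `∇` which behaves like a formal
`-δ⁰ ∇`. All four parts follow from this.

* The equations `δ¹ (T, θ) = 0` become identities between commutators of the operators `∇^A_α` and
  `∇_X`, by flatness of `∇^A`, the Jacobi identity for vector fields and the fact that the anchor
  preserves brackets (`LieAlgebroid.anchor_bracket`). The last fact is not among the axioms of a
  Lie algebroid; it follows from the Jacobi identity and the Leibniz rule, because the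
  differentials of global smooth functions exhaust the covectors at each point.
* Translating the connection by `γ` changes its invariance form by `-δ⁰ γ`
  (`Representation.invarianceForm_vadd`), and a connection is invariant exactly when its invariance
  form vanishes (`Representation.isInvariant_iff`). As the connections form an affine space over
  all `End V`-valued 1-forms (`AConnection.existsUnique_vadd_eq`), the class of the invariance form
  is independent of the connection, the invariant connections form an affine space over `ker δ⁰`,
  and one exists if and only if the invariance form of some connection is in the image of `δ⁰`.
* Linear connections exist (`nonempty_linearConnection`): the flat connections of local frames are
  glued by a partition of unity.
-/

namespace LieAlgd

/-! ### The anchor is a morphism of Lie algebras -/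

section Anchor

variable {E : Type*} [NormedAddCommGroup E] [NormedSpace ℝ E] [FiniteDimensional ℝ E]
  {M : Type*} [TopologicalSpace M] [ChartedSpace E M] [IsManifold 𝓘(ℝ, E) ∞ M] [T2Space M]
  {FA : Type*} [NormedAddCommGroup FA] [NormedSpace ℝ FA] [FiniteDimensional ℝ FA]
  {A : M → Type*} [TopologicalSpace (TotalSpace FA A)]
  [∀ x, AddCommGroup (A x)] [∀ x, Module ℝ (A x)] [∀ x, TopologicalSpace (A x)]
  [FiberBundle FA A] [VectorBundle ℝ FA A] [ContMDiffVectorBundle ∞ FA A 𝓘(ℝ, E)]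

/-- Every covector at a point is the differential of a global smooth function, which is a linear
functional in a chart, cut off by a bump function. -/
theorem exists_fn_mvfderiv_eq (x : M) (l : TangentSpace 𝓘(ℝ, E) x →L[ℝ] ℝ) :
    ∃ f : Fn E M, mvfderiv 𝓘(ℝ, E) f x = l := by
  have hinv := isInvertible_mfderiv_extChartAt (I := 𝓘(ℝ, E)) (mem_extChartAt_source x)
  obtain ⟨e, he⟩ := hinv
  let l' : E →L[ℝ] ℝ := l.comp e.symm.toContinuousLinearMap
  let b : SmoothBumpFunction 𝓘(ℝ, E) x := Classical.arbitrary _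
  have hg : ContMDiffOn 𝓘(ℝ, E) 𝓘(ℝ, ℝ) ∞ (fun y => l' (extChartAt 𝓘(ℝ, E) x y))
      (chartAt E x).source :=
    l'.contMDiff.comp_contMDiffOn (contMDiffOn_extChartAt (n := ∞))
  refine ⟨⟨fun y => b y • l' (extChartAt 𝓘(ℝ, E) x y), b.contMDiff_smul hg⟩, ?_⟩
  have hev : (fun y => b y • l' (extChartAt 𝓘(ℝ, E) x y)) =ᶠ[𝓝 x]
      (l' ∘ extChartAt 𝓘(ℝ, E) x) := by
    filter_upwards [b.eventuallyEq_one] with y hy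
    simp [hy]
  have h1 : mfderiv 𝓘(ℝ, E) 𝓘(ℝ, ℝ) (fun y => b y • l' (extChartAt 𝓘(ℝ, E) x y)) x =
      mfderiv 𝓘(ℝ, E) 𝓘(ℝ, ℝ) (l' ∘ extChartAt 𝓘(ℝ, E) x) x := hev.mfderiv_eq
  have h2 := mfderiv_comp x (I := 𝓘(ℝ, E)) (I' := 𝓘(ℝ, E)) (I'' := 𝓘(ℝ, ℝ))
    (g := l') (f := extChartAt 𝓘(ℝ, E) x) l'.mdifferentiableAt
    (mdifferentiableAt_extChartAt (mem_chart_source E x))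
  ext v
  change mfderiv 𝓘(ℝ, E) 𝓘(ℝ, ℝ) (fun y => b y • l' (extChartAt 𝓘(ℝ, E) x y)) x v = l v
  rw [h1, h2, ← he, l'.mfderiv_eq]
  change l (e.symm (e v)) = l v
  rw [e.symm_apply_apply]

theorem LieAlgebroid.bracket_bracket (𝓐 : LieAlgebroid E FA A) (α β γ : Sec E FA A) :
    𝓐.bracket (𝓐.bracket α β) γ =
      𝓐.bracket α (𝓐.bracket β γ) - 𝓐.bracket β (𝓐.bracket α γ) := by
  have h := 𝓐.jacobi α β γ
  rw [𝓐.bracket_swap γ (𝓐.bracket α β), 𝓐.bracket_swap γ α, map_neg] at h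
  rw [← sub_eq_zero, ← neg_eq_zero, ← h]
  abel

/-- The anchor of a Lie algebroid preserves brackets: by the Jacobi identity and the Leibniz
rule, both vector fields have the same action on the coefficient `f` of a section `f γ`. -/
theorem LieAlgebroid.anchor_bracket (𝓐 : LieAlgebroid E FA A) (α β : Sec E FA A) :
    𝓐.ρ (𝓐.bracket α β) = br (𝓐.ρ α) (𝓐.ρ β) := by
  have key (f : Fn E M) (γ : Sec E FA A) :
      vd (𝓐.ρ (𝓐.bracket α β)) f • γ = vd (br (𝓐.ρ α) (𝓐.ρ β)) f • γ := by
    have h := 𝓐.bracket_bracket α β (f • γ)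
    simp only [𝓐.bracket_fn_smul_right, map_add, 𝓐.bracket_bracket α β γ, smul_sub] at h
    rw [vd_br, sub_smul, ← sub_eq_zero]
    rw [← sub_eq_zero] at h
    rw [← h]
    abel
  ext x
  by_cases hA : ∃ v : A x, v ≠ 0
  · obtain ⟨v, hv⟩ := hA
    obtain ⟨γ, rfl⟩ := exists_section E FA v
    by_contra hne
    obtain ⟨l, hl⟩ := SeparatingDual.exists_separating_of_ne (R := ℝ) (V := E) hne
    obtain ⟨f, hf⟩ := exists_fn_mvfderiv_eq x l
    have := smul_left_injective ℝ hv (congrArg (fun s : Sec E FA A => s x) (key f γ))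
    simp only [vd_apply, hf] at this
    exact hl this
  · -- a zero fibre forces the rank to be zero, so that `A` has no sections besides `0`
    push Not at hA
    have hF (w : FA) : w = 0 := by
      let e := VectorBundle.continuousLinearEquivAt ℝ FA A x
      rw [← e.apply_symm_apply w, hA (e.symm w), map_zero]
    have h0 (σ : Sec E FA A) : σ = 0 := by
      ext y
      exact (VectorBundle.continuousLinearEquivAt ℝ FA A y).injective
        ((hF _).trans (map_zero _).symm)
    have hbr : br (0 : VF E M) 0 = 0 := by simpa using br_smul_left 0 (0 : VF E M) 0
    rw [h0 (𝓐.bracket α β), h0 α, h0 β, map_zero, hbr]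

end Anchor

/-! ### The invariance form is an IM form -/

section InvarianceForm

variable {E : Type*} [NormedAddCommGroup E] [NormedSpace ℝ E] [FiniteDimensional ℝ E]
  {M : Type*} [TopologicalSpace M] [ChartedSpace E M] [IsManifold 𝓘(ℝ, E) ∞ M] [T2Space M]
  {FA : Type*} [NormedAddCommGroup FA] [NormedSpace ℝ FA] [FiniteDimensional ℝ FA]
  {A : M → Type*} [TopologicalSpace (TotalSpace FA A)]
  [∀ x, AddCommGroup (A x)] [∀ x, Module ℝ (A x)] [∀ x, TopologicalSpace (A x)]
  [FiberBundle FA A] [VectorBundle ℝ FA A] [ContMDiffVectorBundle ∞ FA A 𝓘(ℝ, E)]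
  {F : Type*} [NormedAddCommGroup F] [NormedSpace ℝ F] [FiniteDimensional ℝ F]
  {V : M → Type*} [TopologicalSpace (TotalSpace F V)]
  [∀ x, AddCommGroup (V x)] [∀ x, Module ℝ (V x)] [∀ x, TopologicalSpace (V x)]
  [∀ x, IsTopologicalAddGroup (V x)] [∀ x, ContinuousSMul ℝ (V x)]
  [FiberBundle F V] [VectorBundle ℝ F V] [ContMDiffVectorBundle ∞ F V 𝓘(ℝ, E)]

theorem AConnection.sub_left {ρ : Sec E FA A →ₗ[Fn E M] VF E M} (D : AConnection ρ F V)
    (α β : Sec E FA A) (ξ : Sec E F V) : D.D (α - β) ξ = D.D α ξ - D.D β ξ := by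
  rw [eq_sub_iff_add_eq, ← D.add_left, sub_add_cancel]

theorem br_br (X Y Z : VF E M) : br (br X Y) Z = br X (br Y Z) - br Y (br X Z) := by
  rw [br_jacobi X Y Z, add_sub_cancel_right]

/-- The curvature terms in `T` cancel: `T(α)(X)` is minus the failure of `∇^A_α` to commute
with `∇`, `T(α)(X) = -([∇^A_α, ∇_X] - ∇_{[ρ α, X]})`. -/
theorem Representation.tAux_apply_apply {𝓐 : LieAlgebroid E FA A} (R : Representation 𝓐 F V)
    (D : LinearConnection E F V) (α : Sec E FA A) (X : VF E M) (ξ : Sec E F V) :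
    HomSec.toLin (HomSec.toLin (R.tAux D α) X) ξ =
      D.D X (R.D α ξ) - R.D α (D.D X ξ) + D.D (br (𝓐.ρ α) X) ξ := by
  simp only [R.tAux_apply, toLin_sub, AConnection.onEnd_apply, R.theta_apply, D.curv_apply,
    map_sub]
  abel

theorem Representation.onEnd_D_apply {𝓐 : LieAlgebroid E FA A} (R : Representation 𝓐 F V)
    (α : Sec E FA A) (φ : EndSec E F V) (ξ : Sec E F V) :
    HomSec.toLin (R.onEnd.D α φ) ξ = R.D α (HomSec.toLin φ ξ) - HomSec.toLin φ (R.D α ξ) :=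
  R.toAConnection.onEnd_apply α φ ξ

theorem Representation.lie_onEnd_apply {𝓐 : LieAlgebroid E FA A} (R : Representation 𝓐 F V)
    (α : Sec E FA A) (γ : Form1 E (F →L[ℝ] F) (fun x => V x →L[ℝ] V x)) (X : VF E M)
    (ξ : Sec E F V) :
    HomSec.toLin (HomSec.toLin (R.onEnd.lie α γ) X) ξ =
      R.D α (HomSec.toLin (HomSec.toLin γ X) ξ) - HomSec.toLin (HomSec.toLin γ X) (R.D α ξ) -
        HomSec.toLin (HomSec.toLin γ (br (𝓐.ρ α) X)) ξ := by
  rw [R.onEnd.lie_apply, toLin_sub, R.onEnd_D_apply]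

theorem Representation.invarianceForm_mem_imForms {𝓐 : LieAlgebroid E FA A}
    (R : Representation 𝓐 F V) (D : LinearConnection E F V) :
    R.invarianceForm D ∈ R.onEnd.imForms := by
  refine LinearMap.mem_ker.2 (Subtype.ext (Prod.ext (LinearMap.ext₂ fun α β => ?_)
    (LinearMap.ext fun α => homSec_ext fun β => ?_)))
  · change R.onEnd.lie α (R.tAux D β) - R.onEnd.lie β (R.tAux D α) -
      R.tAux D (𝓐.bracket α β) = 0
    refine homSec_ext fun X => homSec_ext fun ξ => ?_
    simp only [toLin_sub, toLin_zero, R.lie_onEnd_apply, R.tAux_apply_apply, R.flat,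
      𝓐.anchor_bracket, br_br, D.sub_left, map_add, map_sub]
    abel
  · change HomSec.toLin (R.onEnd.d₁One (R.invarianceForm D) α) β = 0
    rw [R.onEnd.d₁One_apply]
    change -R.onEnd.D α (HomSec.toLin (R.theta D) β) +
      HomSec.toLin (R.theta D) (𝓐.bracket α β) + HomSec.toLin (R.tAux D α) (𝓐.ρ β) = 0
    refine homSec_ext fun ξ => ?_
    have hn (φ : EndSec E F V) : HomSec.toLin (-φ) ξ = -HomSec.toLin φ ξ := rfl
    simp only [toLin_add, toLin_zero, hn, R.onEnd_D_apply, R.theta_apply, R.tAux_apply_apply,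
      R.flat, 𝓐.anchor_bracket, map_sub]
    abel

/-! ### Invariance and translation of connections -/

/-- A connection is invariant exactly when its invariance form vanishes: once `θ = 0`, the form
`T` reduces to minus the contracted curvature. -/
theorem Representation.isInvariant_iff {𝓐 : LieAlgebroid E FA A} (R : Representation 𝓐 F V)
    (D : LinearConnection E F V) : R.IsInvariant D ↔ R.invarianceForm D = 0 := by
  have hθ : (∀ α ξ, R.D α ξ = D.D (𝓐.ρ α) ξ) ↔ R.theta D = 0 := by
    constructor
    · exact fun h => homSec_ext fun α => homSec_ext fun ξ => by
        rw [R.theta_apply, h, sub_self]; rfl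
    · intro h α ξ
      rw [← sub_eq_zero, ← R.theta_apply, h]; rfl
  have hT (h : R.theta D = 0) (α : Sec E FA A) : R.tAux D α = -D.iotaCurv (𝓐.ρ α) := by
    refine homSec_ext fun X => ?_
    rw [R.tAux_apply, h, toLin_zero, map_zero, zero_sub, ← D.iotaCurv_apply]; rfl
  constructor
  · rintro ⟨h1, h2⟩
    have h := hθ.1 h1
    refine Subtype.ext (Prod.ext (LinearMap.ext fun α => ?_) h)
    change R.tAux D α = 0
    rw [hT h, h2, neg_zero]
  · intro h
    have h1 : R.theta D = 0 := congrArg (fun c => c.1.2) h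
    refine ⟨hθ.2 h1, fun α => neg_eq_zero.1 ?_⟩
    rw [← hT h1]
    exact congrArg (fun c => c.1.1 α) h

theorem AConnection.vadd_apply (D : LinearConnection E F V)
    (γ : Form1 E (F →L[ℝ] F) (fun x => V x →L[ℝ] V x)) (X : VF E M) (ξ : Sec E F V) :
    (γ +ᵥ D).D X ξ = D.D X ξ + HomSec.toLin (HomSec.toLin γ X) ξ := rfl

/-- Translating a connection changes its invariance form by a coboundary. -/
theorem Representation.invarianceForm_vadd {𝓐 : LieAlgebroid E FA A} (R : Representation 𝓐 F V)
    (D : LinearConnection E F V) (γ : Form1 E (F →L[ℝ] F) (fun x => V x →L[ℝ] V x)) :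
    R.invarianceForm (γ +ᵥ D) = R.invarianceForm D - R.onEnd.δ₀ γ := by
  refine Subtype.ext (Prod.ext (LinearMap.ext fun α => ?_) (homSec_ext fun α => ?_))
  · change R.tAux (γ +ᵥ D) α = R.tAux D α - R.onEnd.lie α γ
    refine homSec_ext fun X => homSec_ext fun ξ => ?_
    simp only [toLin_sub, R.lie_onEnd_apply, R.tAux_apply_apply, AConnection.vadd_apply, map_add]
    abel
  · change HomSec.toLin (R.theta (γ +ᵥ D)) α =
      HomSec.toLin (R.theta D) α - HomSec.toLin (𝓐.contract γ) α
    refine homSec_ext fun ξ => ?_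
    simp only [toLin_sub, 𝓐.contract_apply, R.theta_apply, AConnection.vadd_apply]
    abel

/-- Two linear connections differ by a unique `End V`-valued 1-form. -/
theorem AConnection.existsUnique_vadd_eq (D D' : LinearConnection E F V) :
    ∃! γ : Form1 E (F →L[ℝ] F) (fun x => V x →L[ℝ] V x), γ +ᵥ D = D' := by
  let δ (X : VF E M) : EndSec E F V := homOfLin
    { toFun := fun ξ => D'.D X ξ - D.D X ξ
      map_add' := fun ξ η => by simp only [map_add]; abel
      map_smul' := fun f ξ => by
        simp only [D.leibniz, D'.leibniz, RingHom.id_apply, smul_sub]; abel }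
  have hδ (X : VF E M) (ξ : Sec E F V) : HomSec.toLin (δ X) ξ = D'.D X ξ - D.D X ξ := by
    simp only [δ, toLin_homOfLin]; rfl
  let γ : Form1 E (F →L[ℝ] F) (fun x => V x →L[ℝ] V x) := homOfLin
    { toFun := δ
      map_add' := fun X Y => homSec_ext fun ξ => by
        simp only [hδ, toLin_add, AConnection.add_left]; abel
      map_smul' := fun f X => homSec_ext fun ξ => by
        simp only [hδ, toLin_fn_smul, AConnection.smul_left, RingHom.id_apply, smul_sub] }
  have hγ (X : VF E M) : HomSec.toLin γ X = δ X := by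
    simp only [γ, toLin_homOfLin]; rfl
  refine ⟨γ, AConnection.ext_apply fun X ξ => ?_, fun γ' h => ?_⟩
  · rw [AConnection.vadd_apply, hγ, hδ, add_sub_cancel]
  · refine homSec_ext fun X => homSec_ext fun ξ => ?_
    rw [hγ, hδ, ← h, AConnection.vadd_apply, add_sub_cancel_left]

end InvarianceForm

/-! ### Existence of linear connections -/

section Existence

variable {E : Type*} [NormedAddCommGroup E] [NormedSpace ℝ E] [FiniteDimensional ℝ E]
  {M : Type*} [TopologicalSpace M] [ChartedSpace E M] [IsManifold 𝓘(ℝ, E) ∞ M] [T2Space M]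

theorem vd_congr_of_eventuallyEq (X : VF E M) {f g : Fn E M} {x : M} (h : f =ᶠ[𝓝 x] g) :
    vd X f x = vd X g x := by
  have h' : mfderiv 𝓘(ℝ, E) 𝓘(ℝ, ℝ) f x = mfderiv 𝓘(ℝ, E) 𝓘(ℝ, ℝ) g x := h.mfderiv_eq
  change mfderiv 𝓘(ℝ, E) 𝓘(ℝ, ℝ) f x (X x) = mfderiv 𝓘(ℝ, E) 𝓘(ℝ, ℝ) g x (X x)
  rw [h']; rfl

theorem vd_const (X : VF E M) (r : ℝ) : vd X (r • (1 : Fn E M)) = 0 := by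
  ext x
  rw [vd_apply]
  have : (⇑(r • (1 : Fn E M)) : M → ℝ) = fun _ => r := by ext y; simp
  rw [this, mvfderiv_const]; rfl

variable (E)
  (F : Type*) [NormedAddCommGroup F] [NormedSpace ℝ F] [FiniteDimensional ℝ F]
  (V : M → Type*) [TopologicalSpace (TotalSpace F V)]
  [∀ x, AddCommGroup (V x)] [∀ x, Module ℝ (V x)] [∀ x, TopologicalSpace (V x)]
  [FiberBundle F V] [VectorBundle ℝ F V] [ContMDiffVectorBundle ∞ F V 𝓘(ℝ, E)]

/-- Around every point there are global sections `s i` that restrict to a local frame, and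
globally defined functions `c i σ` that restrict to the coefficients of `σ` in that frame. -/
theorem exists_global_frame_coeff (x₀ : M) :
    ∃ U : Set M, IsOpen U ∧ x₀ ∈ U ∧
      ∃ (s : Fin (Module.finrank ℝ F) → Sec E F V)
        (c : Fin (Module.finrank ℝ F) → Sec E F V → Fn E M), ∀ y ∈ U,
        (∀ i σ τ, c i (σ + τ) y = c i σ y + c i τ y) ∧
        (∀ i (f : Fn E M) σ, c i (f • σ) y = f y * c i σ y) ∧
        ∀ σ, ∑ i, c i σ y • s i y = σ y := by
  obtain ⟨ψ, s, c, hψ, hs, -, hsum⟩ := exists_cutoff_frame E F V x₀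
  set t := trivializationAt F V x₀
  have hx₀ : x₀ ∈ t.baseSet := FiberBundle.mem_baseSet_trivializationAt F V x₀
  obtain ⟨U, hU, hUo, hxU⟩ := eventually_nhds_iff.1
    ((hψ.and hs).and (t.open_baseSet.mem_nhds hx₀))
  refine ⟨U, hUo, hxU, s, c, fun y hy => ?_⟩
  obtain ⟨⟨hψy, hsy⟩, hyt⟩ := hU y hy
  have hdec (σ : Sec E F V) : ∑ i, c i σ y • s i y = σ y := by
    have h := congrArg (fun s : Sec E F V => s y) (hsum σ)
    simp only [fn_smul_apply, hψy, one_smul, sum_apply] at h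
    exact h.symm
  -- at `y` the function `c i σ` is a coordinate of `σ y`, hence linear in `σ`
  have hcoord (i) (σ : Sec E F V) :
      c i σ y = (Module.finBasis ℝ F).repr (t.linearEquivAt ℝ y hyt (σ y)) i := by
    have hsi (j) : t.linearEquivAt ℝ y hyt (s j y) = Module.finBasis ℝ F j := hsy j
    rw [← hdec σ, map_sum]
    simp only [map_smul, hsi]
    rw [(Module.finBasis ℝ F).repr_sum_self]
  refine ⟨fun i σ τ => ?_, fun i f σ => ?_, hdec⟩
  · simp only [hcoord, add_apply, map_add, Finsupp.add_apply]
  · simp only [hcoord, fn_smul_apply, map_smul, Finsupp.smul_apply, smul_eq_mul]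

/-- Around every point there are operators which near that point satisfy the rules of a linear
connection: the flat connection of a local frame. -/
theorem exists_local_connection (x₀ : M) :
    ∃ U : Set M, IsOpen U ∧ x₀ ∈ U ∧ ∃ P : VF E M → Sec E F V → Sec E F V,
      (∀ X Y σ, P (X + Y) σ = P X σ + P Y σ) ∧
      (∀ (f : Fn E M) X σ, P (f • X) σ = f • P X σ) ∧
      ∀ y ∈ U, (∀ X σ τ, P X (σ + τ) y = P X σ y + P X τ y) ∧
        ∀ X (f : Fn E M) σ, P X (f • σ) y = f y • P X σ y + vd X f y • σ y := by
  obtain ⟨U, hUo, hxU, s, c, h⟩ := exists_global_frame_coeff E F V x₀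
  refine ⟨U, hUo, hxU, fun X σ => ∑ i, vd X (c i σ) • s i, fun X Y σ => ?_, fun f X σ => ?_,
    fun y hy => ⟨fun X σ τ => ?_, fun X f σ => ?_⟩⟩
  · simp only [vd_add_left, add_smul, Finset.sum_add_distrib]
  · simp only [vd_fn_smul_left, mul_smul, Finset.smul_sum]
  · have hc (i) : vd X (c i (σ + τ)) y = vd X (c i σ) y + vd X (c i τ) y := by
      change _ = (vd X (c i σ) + vd X (c i τ)) y
      rw [← vd_add]
      refine vd_congr_of_eventuallyEq X ?_
      filter_upwards [hUo.mem_nhds hy] with z hz using (h z hz).1 i σ τ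
    simp only [sum_apply, fn_smul_apply, hc, add_smul, Finset.sum_add_distrib]
  · have hc (i) : vd X (c i (f • σ)) y = f y * vd X (c i σ) y + c i σ y * vd X f y := by
      have : vd X (c i (f • σ)) y = vd X (f * c i σ) y := by
        refine vd_congr_of_eventuallyEq X ?_
        filter_upwards [hUo.mem_nhds hy] with z hz using (h z hz).2.1 i f σ
      rw [this, vd_mul]; rfl
    simp only [sum_apply, fn_smul_apply, hc, add_smul, Finset.sum_add_distrib]
    congr 1
    · simp only [mul_smul, Finset.smul_sum]
    · conv_rhs => rw [← (h y hy).2.2 σ, Finset.smul_sum]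
      simp only [smul_smul, mul_comm]

/-- Linear connections exist: a partition of unity glues the local ones, and the Leibniz rule
survives because its inhomogeneous term `(X f) σ` is the same for all of them. -/
theorem nonempty_linearConnection [SecondCountableTopology M] :
    Nonempty (LinearConnection E F V) := by
  have : LocallyCompactSpace M := Manifold.locallyCompact_of_finiteDimensional 𝓘(ℝ, E)
  choose U hUo hxU P hadd hsmul hP using exists_local_connection E F V
  obtain ⟨φ, hφ⟩ := SmoothPartitionOfUnity.exists_isSubordinate 𝓘(ℝ, E) isClosed_univ U hUo
    fun x _ => Set.mem_iUnion.2 ⟨x, hxU x⟩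
  let D (X : VF E M) (σ : Sec E F V) : Sec E F V :=
    ⟨fun y => ∑ᶠ i, φ i y • P i X σ y, by
      refine ContMDiff.finsum_section_of_locallyFinite ?_
        fun i => (φ i).contMDiff.smul_section (P i X σ).contMDiff
      refine φ.locallyFinite.subset fun i y hy h => hy ?_
      simp only [h, zero_smul]⟩
  have hD (X σ y) : D X σ y = ∑ i ∈ φ.finsupport y, φ i y • P i X σ y :=
    (φ.sum_finsupport_smul_eq_finsum y fun i _ => P i X σ y).symm
  have hmem {y i} (hi : i ∈ φ.finsupport y) : y ∈ U i :=
    hφ i (subset_tsupport _ ((φ.mem_finsupport y).1 hi))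
  have hleib (X) (f : Fn E M) (σ) : D X (f • σ) = f • D X σ + vd X f • σ := by
    ext y
    have h1 : ∑ i ∈ φ.finsupport y, φ i y = 1 := φ.sum_finsupport y (Set.mem_univ y)
    have h2 : vd X f y • σ y = ∑ i ∈ φ.finsupport y, φ i y • vd X f y • σ y := by
      rw [← Finset.sum_smul, h1, one_smul]
    rw [add_apply, fn_smul_apply, fn_smul_apply, hD, hD, h2, Finset.smul_sum,
      ← Finset.sum_add_distrib]
    refine Finset.sum_congr rfl fun i hi => ?_
    rw [(hP i y (hmem hi)).2, smul_add, smul_comm (φ i y) (f y)]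
  refine ⟨
    { D := fun X =>
        { toFun := D X
          map_add' := fun σ τ => ?_
          map_smul' := fun r σ => ?_ }
      add_left := fun X Y σ => ?_
      smul_left := fun f X σ => ?_
      leibniz := hleib }⟩
  · ext y
    rw [add_apply, hD, hD, hD, ← Finset.sum_add_distrib]
    exact Finset.sum_congr rfl fun i hi => by rw [(hP i y (hmem hi)).1, smul_add]
  · have h := hleib X (r • 1) σ
    rwa [vd_const, zero_smul, add_zero, smul_one_smul, smul_one_smul] at h
  · ext y
    change D (X + Y) σ y = D X σ y + D Y σ y
    rw [hD, hD, hD, ← Finset.sum_add_distrib]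
    exact Finset.sum_congr rfl fun i _ => by rw [hadd, add_apply, smul_add]
  · ext y
    change D (f • X) σ y = f y • D X σ y
    rw [hD, hD, Finset.smul_sum]
    exact Finset.sum_congr rfl fun i _ => by rw [hsmul, fn_smul_apply, smul_comm]

end Existence
end LieAlgd

/-! ### The obstruction class -/

theorem mainTheorem10
    {E : Type*} [NormedAddCommGroup E] [NormedSpace ℝ E] [FiniteDimensional ℝ E]
    {M : Type*} [TopologicalSpace M] [ChartedSpace E M] [IsManifold 𝓘(ℝ, E) ∞ M]
    [T2Space M] [SecondCountableTopology M]
    {FA : Type*} [NormedAddCommGroup FA] [NormedSpace ℝ FA] [FiniteDimensional ℝ FA]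
    {A : M → Type*} [TopologicalSpace (TotalSpace FA A)]
    [∀ x, AddCommGroup (A x)] [∀ x, Module ℝ (A x)] [∀ x, TopologicalSpace (A x)]
    [FiberBundle FA A] [VectorBundle ℝ FA A] [ContMDiffVectorBundle ∞ FA A 𝓘(ℝ, E)]
    {F : Type*} [NormedAddCommGroup F] [NormedSpace ℝ F] [FiniteDimensional ℝ F]
    {V : M → Type*} [TopologicalSpace (TotalSpace F V)]
    [∀ x, AddCommGroup (V x)] [∀ x, Module ℝ (V x)] [∀ x, TopologicalSpace (V x)]
    [∀ x, IsTopologicalAddGroup (V x)] [∀ x, ContinuousSMul ℝ (V x)]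
    [FiberBundle F V] [VectorBundle ℝ F V] [ContMDiffVectorBundle ∞ F V 𝓘(ℝ, E)]
    (𝓐 : LieAlgd.LieAlgebroid E FA A) (R : LieAlgd.Representation 𝓐 F V) :
    -- the invariance form of any connection is an IM form
    ∃ him : ∀ D : LieAlgd.LinearConnection E F V, R.invarianceForm D ∈ R.onEnd.imForms,
      -- the invariant connections form an affine space over the invariant 1-forms
      ((∀ D : LieAlgd.LinearConnection E F V, R.IsInvariant D →
          ∀ γ ∈ R.onEnd.invForms, R.IsInvariant (γ +ᵥ D)) ∧
        (∀ D D' : LieAlgd.LinearConnection E F V, R.IsInvariant D → R.IsInvariant D' →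
          ∃! γ : LieAlgd.Form1 E (F →L[ℝ] F) (fun x => V x →L[ℝ] V x),
            γ ∈ R.onEnd.invForms ∧ γ +ᵥ D = D')) ∧
      -- connections exist, the class of the invariance form is the same for all of them, and
      -- it vanishes if and only if an invariant connection exists
      Nonempty (LieAlgd.LinearConnection E F V) ∧
      ∃ obs : R.onEnd.H11,
        (∀ D : LieAlgd.LinearConnection E F V,
          R.onEnd.toH11 (R.invarianceForm D) (him D) = obs) ∧
        ((∃ D : LieAlgd.LinearConnection E F V, R.IsInvariant D) ↔ obs = 0) := by
  obtain ⟨D₀⟩ := LieAlgd.nonempty_linearConnection E F V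
  refine ⟨R.invarianceForm_mem_imForms, ⟨fun D hD γ hγ => ?_, fun D D' hD hD' => ?_⟩, ⟨D₀⟩,
    R.onEnd.toH11 (R.invarianceForm D₀) (R.invarianceForm_mem_imForms D₀), fun D => ?_, ?_⟩
  · rw [R.isInvariant_iff] at hD ⊢
    rw [R.invarianceForm_vadd, hD, LinearMap.mem_ker.1 hγ, sub_zero]
  · obtain ⟨γ, hγ, huniq⟩ := D.existsUnique_vadd_eq D'
    refine ⟨γ, ⟨LinearMap.mem_ker.2 ?_, hγ⟩, fun γ' h => huniq γ' h.2⟩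
    rw [R.isInvariant_iff] at hD hD'
    rw [← hγ, R.invarianceForm_vadd, hD, zero_sub] at hD'
    exact neg_eq_zero.1 hD'
  · obtain ⟨γ, rfl, -⟩ := D.existsUnique_vadd_eq D₀
    refine (Submodule.Quotient.eq _).2 (Submodule.mem_comap.2 ⟨γ, ?_⟩)
    change _ = R.invarianceForm D - R.invarianceForm (γ +ᵥ D)
    rw [R.invarianceForm_vadd, sub_sub_cancel]
  · constructor
    · rintro ⟨D, hD⟩
      obtain ⟨γ, rfl, -⟩ := D.existsUnique_vadd_eq D₀
      refine (Submodule.Quotient.mk_eq_zero _).2 (Submodule.mem_comap.2 ⟨-γ, ?_⟩)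
      change _ = R.invarianceForm (γ +ᵥ D)
      rw [R.invarianceForm_vadd, (R.isInvariant_iff D).1 hD, zero_sub, map_neg]
    · intro h
      obtain ⟨γ, hγ⟩ := Submodule.mem_comap.1 ((Submodule.Quotient.mk_eq_zero _).1 h)
      refine ⟨γ +ᵥ D₀, (R.isInvariant_iff _).2 ?_⟩
      rw [R.invarianceForm_vadd, hγ]
      exact sub_self _
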